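/- Let $r\colon\mathbb R\to\mathbb R$ be a smooth function with $r>0$ on $(0,1)$, $r(0)=r(1)=0$ and $|r'(0)|,|r'(1)|<\frac1{2\pi}$. Let $\Sigma$ be the surface of revolution in $\mathbb R^3$ parametrized by $$X\colon(0,1)\times\mathbb R\to\mathbb R^3,\qquad (x,\phi)\mapsto(x,\,r(x)\cos\phi,\,r(x)\sin\phi),$$ and let $k=[1+(r'(x))^2]\,dx^2+r(x)^2\,d\phi^2$ be the Riemannian metric on $\Sigma$ induced by the Euclidean metric of $\mathbb R^3$. Denote by $\operatorname{dist}_k(p,q)$ the infimum of the $k$-lengths of $C^1$ curves in $\Sigma$ from $p$ to $q$. Consider the spacetime $(M,g)=(\mathbb R\times\Sigma,\,-dt^2+k)$, time-oriented by $\partial_t$. Let $J^+\subset M\times M$ be its causal relation, i.e. the set of pairs $(a,b)$ such that $a=b$ or there is a future-directed causal piecewise $C^1$ curve from $a$ to $b$. Then $(M,g)$ is causally simple, that is, there is no closed future-directed causal curve in $M$, and $J^+$ is a closed subset of $M\times M$. Moreover, for all $\sigma,\tau\in\mathbb R$ and $p,q\in\Sigma$, $$((\sigma,p),(\tau,q))\in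 J^+\iff \tau-\sigma\ge\operatorname{dist}_k(p,q).$$ -/

import Mathlib

open Bundle Set Manifold
open scoped ContDiff

noncomputable section

/-! ### Smooth fields of bilinear forms on a manifold -/

section Forms

variable {E : Type*} [NormedAddCommGroup E] [NormedSpace ℝ E] {H : Type*} [TopologicalSpace H]
  {I : ModelWithCorners ℝ E H} {M : Type*} [TopologicalSpace M] [ChartedSpace H M]
  {E' : Type*} [NormedAddCommGroup E'] [NormedSpace ℝ E'] {H' : Type*} [TopologicalSpace H']
  {J : ModelWithCorners ℝ E' H'} {N : Type*} [TopologicalSpace N] [ChartedSpace H' N]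

variable (I M) in
/-- A field of continuous bilinear forms on the tangent spaces of `M`. -/
abbrev FormField : Type _ := ∀ x : M, TangentSpace I x →L[ℝ] TangentSpace I x →L[ℝ] ℝ

/-- The field `B` is a smooth (`C^∞`) section of the bundle of bilinear forms. -/
def FormField.IsSmooth [IsManifold I ∞ M] (B : FormField I M) : Prop :=
  ContMDiff I (I.prod 𝓘(ℝ, E →L[ℝ] E →L[ℝ] ℝ)) ∞
    (fun x : M ↦ TotalSpace.mk' (E →L[ℝ] E →L[ℝ] ℝ)
      (E := fun x : M ↦ TangentSpace I x →L[ℝ] TangentSpace I x →L[ℝ] ℝ) x (B x))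

variable (I J) in
/-- The pullback `f^* B`, that is `(f^* B)_x (v, w) = B_{f x} (df v, df w)`. -/
def FormField.pullback (f : M → N) (B : FormField J N) : FormField I M := fun x ↦
  let b : E' →L[ℝ] E' →L[ℝ] ℝ := B (f x)
  let df : E →L[ℝ] E' := mfderiv I J f x
  (b.bilinearComp df df : E →L[ℝ] E →L[ℝ] ℝ)

theorem FormField.pullback_apply (f : M → N) (B : FormField J N) (x : M) (v w : TangentSpace I x) :
    FormField.pullback I J f B x v w = B (f x) (mfderiv I J f x v) (mfderiv I J f x w) := rfl

theorem FormField.IsSmooth.pullback [IsManifold I ∞ M] [IsManifold J ∞ N] {f : M → N}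
    {B : FormField J N} (hB : B.IsSmooth) (hf : ContMDiff I J ∞ f) :
    (FormField.pullback I J f B).IsSmooth := by
  intro x₀
  refine (contMDiffAt_hom_bundle _).2 ⟨contMDiffAt_id, ?_⟩
  have hA := (hf x₀).mfderiv_const (m := ∞) le_rfl
  have hB' := ((contMDiffAt_hom_bundle _).1 (hB (f x₀))).2.comp x₀ (hf x₀)
  have key : ContMDiffAt I 𝓘(ℝ, E →L[ℝ] E →L[ℝ] ℝ) ∞ (fun x ↦
      ((ContinuousLinearMap.compL ℝ E E' ℝ).flip
        (inTangentCoordinates I J id f (mfderiv I J f) x₀ x)).comp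
      ((ContinuousLinearMap.inCoordinates E' (TangentSpace J) (E' →L[ℝ] ℝ)
        (fun y : N ↦ TangentSpace J y →L[ℝ] ℝ) (f x₀) (f x) (f x₀) (f x) (B (f x))).comp
        (inTangentCoordinates I J id f (mfderiv I J f) x₀ x))) x₀ := by
    refine ContMDiffAt.clm_comp ?_ (ContMDiffAt.clm_comp hB' hA)
    exact (ContinuousLinearMap.contDiff _).contMDiff.contMDiffAt.comp x₀ hA
  refine key.congr_of_eventuallyEq ?_
  have h1 : ∀ᶠ x in nhds x₀, x ∈ (trivializationAt E (TangentSpace I) x₀).baseSet :=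
    (trivializationAt E (TangentSpace I) x₀).open_baseSet.mem_nhds
      (FiberBundle.mem_baseSet_trivializationAt' x₀)
  have h2 : ∀ᶠ x in nhds x₀, f x ∈ (trivializationAt E' (TangentSpace J) (f x₀)).baseSet :=
    hf.continuous.continuousAt.preimage_mem_nhds
      ((trivializationAt E' (TangentSpace J) (f x₀)).open_baseSet.mem_nhds
      (FiberBundle.mem_baseSet_trivializationAt' (f x₀)))
  filter_upwards [h1, h2] with x hx hfx
  ext v w
  rw [inCoordinates_apply_eq₂ (by exact hx) (by exact hx) (by simp)]
  simp only [ContinuousLinearMap.comp_apply, ContinuousLinearMap.flip_apply,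
    ContinuousLinearMap.compL_apply]
  rw [inCoordinates_apply_eq₂ (by exact hfx) (by exact hfx) (by simp)]
  have hd : ∀ v : E, (trivializationAt E' (TangentSpace J) (f x₀)).symm (f x)
      (inTangentCoordinates I J id f (mfderiv I J f) x₀ x v) =
      mfderiv I J f x ((trivializationAt E (TangentSpace I) x₀).symm x v) := by
    intro v
    change (trivializationAt E' (TangentSpace J) (f x₀)).symm (f x)
      ((trivializationAt E' (TangentSpace J) (f x₀)).continuousLinearMapAt ℝ (f x)
        (mfderiv I J f x ((trivializationAt E (TangentSpace I) x₀).symmL ℝ x v))) = _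
    rw [← Trivialization.symmL_apply (R := ℝ) _ hfx, ← Trivialization.symmL_apply (R := ℝ) _ hx,
      Trivialization.symmL_continuousLinearMapAt _ hfx]
  rw [hd, hd]
  rfl

theorem FormField.IsSmooth.add [IsManifold I ∞ M] {B C : FormField I M} (hB : B.IsSmooth)
    (hC : C.IsSmooth) : FormField.IsSmooth (B + C) :=
  ContMDiff.add_section hB hC

theorem FormField.IsSmooth.neg [IsManifold I ∞ M] {B : FormField I M} (hB : B.IsSmooth) :
    FormField.IsSmooth (-B) :=
  ContMDiff.neg_section hB

/-- The Euclidean metric of an inner product space, as a field of forms. -/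
def euclideanForm (F : Type*) [NormedAddCommGroup F] [InnerProductSpace ℝ F] :
    FormField 𝓘(ℝ, F) F := (riemannianMetricVectorSpace F).inner

theorem euclideanForm_isSmooth (F : Type*) [NormedAddCommGroup F] [InnerProductSpace ℝ F] :
    (euclideanForm F).IsSmooth :=
  (riemannianMetricVectorSpace F).contMDiff.of_le le_top

end Forms

/-! ### Spacetimes and causality -/

section Causality

variable {E : Type*} [NormedAddCommGroup E] [NormedSpace ℝ E] {H : Type*} [TopologicalSpace H]

/-- A time-oriented Lorentzian metric on the manifold `M`: a smooth field `metric` of symmetric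
bilinear forms of signature `(-, +, …, +)`, with a continuous timelike vector field `timeField`
giving the time orientation. The signature is expressed by saying that `timeField` is timelike and
that `metric` is positive definite on the orthogonal complement of `timeField`. -/
structure Spacetime (I : ModelWithCorners ℝ E H) (M : Type*) [TopologicalSpace M]
    [ChartedSpace H M] [IsManifold I ∞ M] where
  metric : FormField I M
  isSmooth : metric.IsSmooth
  symm : ∀ (x : M) (v w : TangentSpace I x), metric x v w = metric x w v
  timeField : ∀ x : M, TangentSpace I x
  continuous_timeField : Continuous (fun x : M ↦ (⟨x, timeField x⟩ : TangentBundle I M))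
  timelike : ∀ x : M, metric x (timeField x) (timeField x) < 0
  pos : ∀ (x : M) (v : TangentSpace I x), v ≠ 0 → metric x (timeField x) v = 0 → 0 < metric x v v

namespace Spacetime

variable {I : ModelWithCorners ℝ E H} {M : Type*} [TopologicalSpace M]
  [ChartedSpace H M] [IsManifold I ∞ M] (S : Spacetime I M)

/-- A tangent vector is future-directed causal if it is nonzero, timelike or null, and in the same
half-cone as the time orientation. -/
def IsFutureCausal (x : M) (v : TangentSpace I x) : Prop :=
  v ≠ 0 ∧ S.metric x v v ≤ 0 ∧ S.metric x v (S.timeField x) < 0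

/-- `p` is joined to `q` by a future-directed causal `C^1` curve `γ : [a, b] → M`, `a < b`. -/
def JoinedByCausalArc (p q : M) : Prop :=
  ∃ (a b : ℝ) (γ : ℝ → M), a < b ∧ γ a = p ∧ γ b = q ∧
    ContMDiffOn 𝓘(ℝ, ℝ) I 1 γ (Icc a b) ∧
    ∀ t ∈ Icc a b, S.IsFutureCausal (γ t) (mfderivWithin 𝓘(ℝ, ℝ) I γ (Icc a b) t (1 : ℝ))

/-- `p` is joined to `q` by a future-directed causal piecewise `C^1` curve, i.e. by a nonempty finite
concatenation of future-directed causal `C^1` curves. -/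
def JoinedByCausalCurve (p q : M) : Prop := Relation.TransGen S.JoinedByCausalArc p q

/-- The causal relation `J^+`, as a subset of `M × M`. -/
def causalRelation : Set (M × M) := {x | x.1 = x.2 ∨ S.JoinedByCausalCurve x.1 x.2}

/-- A spacetime is causal if it contains no closed future-directed causal curve. -/
def IsCausal : Prop := ∀ p : M, ¬ S.JoinedByCausalCurve p p

/-- A spacetime is causally simple if it is causal and its causal relation is closed. -/
def IsCausallySimple : Prop := S.IsCausal ∧ IsClosed S.causalRelation

end Spacetime

end Causality

/-! ### The surface of revolution -/

section Surface

/-- The open interval `(0, 1)` as a manifold. -/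
abbrev UnitIoo : TopologicalSpace.Opens ℝ := ⟨Ioo 0 1, isOpen_Ioo⟩

/-- The surface of revolution as an abstract smooth manifold `(0, 1) × S¹`: the point
`(x, exp (i φ))` stands for the point `(x, r x cos φ, r x sin φ)` of `ℝ³`. -/
abbrev RevSurface : Type := UnitIoo × Circle

/-- The model of the two-dimensional manifold `(0, 1) × S¹`. -/
abbrev revModel : ModelWithCorners ℝ (ℝ × EuclideanSpace ℝ (Fin 1))
    (ModelProd ℝ (EuclideanSpace ℝ (Fin 1))) := 𝓘(ℝ, ℝ).prod (𝓡 1)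

/-- The embedding of the surface of revolution with profile `r` into `ℝ³`. -/
def revEmbedding (r : ℝ → ℝ) (p : RevSurface) : EuclideanSpace ℝ (Fin 3) :=
  !₂[(p.1 : ℝ), r p.1 * (p.2 : ℂ).re, r p.1 * (p.2 : ℂ).im]

theorem revEmbedding_exp (r : ℝ → ℝ) (x : UnitIoo) (φ : ℝ) :
    revEmbedding r (x, Circle.exp φ) = !₂[(x : ℝ), r x * Real.cos φ, r x * Real.sin φ] := by
  simp [revEmbedding, Circle.coe_exp, Complex.exp_ofReal_mul_I_re, Complex.exp_ofReal_mul_I_im]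

theorem revEmbedding_injective (r : ℝ → ℝ) (hpos : ∀ x ∈ Ioo (0 : ℝ) 1, 0 < r x) :
    Function.Injective (revEmbedding r) := by
  rintro ⟨x, z⟩ ⟨y, w⟩ h
  have h0 := congrArg (fun v : EuclideanSpace ℝ (Fin 3) ↦ v 0) h
  have h1 := congrArg (fun v : EuclideanSpace ℝ (Fin 3) ↦ v 1) h
  have h2 := congrArg (fun v : EuclideanSpace ℝ (Fin 3) ↦ v 2) h
  simp [revEmbedding] at h0 h1 h2
  obtain rfl : x = y := h0
  have hx : r x ≠ 0 := (hpos x x.2).ne'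
  have : z = w := Circle.ext (Complex.ext (by simpa [hx] using h1) (by simpa [hx] using h2))
  rw [this]

/-- The coordinates `(x, exp (i φ))`, as a map to `ℝ × ℂ`. -/
def revCoord : RevSurface → ℝ × ℂ := Prod.map Subtype.val (fun z : Circle ↦ (z : ℂ))

theorem contMDiff_circle_coe : ContMDiff (𝓡 1) 𝓘(ℝ, ℂ) ∞ (fun z : Circle ↦ (z : ℂ)) :=
  haveI : Fact (Module.finrank ℝ ℂ = 1 + 1) := finrank_real_complex_fact'
  contMDiff_coe_sphere (E := ℂ) (n := 1)

theorem contMDiff_revCoord : ContMDiff revModel 𝓘(ℝ, ℝ × ℂ) ∞ revCoord := by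
  rw [modelWithCornersSelf_prod, ← chartedSpaceSelf_prod]
  exact contMDiff_subtype_val.prodMap contMDiff_circle_coe

theorem mfderiv_revCoord_injective (p : RevSurface) :
    Function.Injective (mfderiv revModel 𝓘(ℝ, ℝ × ℂ) revCoord p) := by
  have h1 : Function.Injective
      (mfderiv 𝓘(ℝ, ℝ) 𝓘(ℝ, ℝ) (Subtype.val : UnitIoo → ℝ) p.1) := by
    let g : ℝ → UnitIoo := fun y ↦ if h : y ∈ Ioo (0 : ℝ) 1 then ⟨y, h⟩ else p.1
    have hg : ContMDiffAt 𝓘(ℝ, ℝ) 𝓘(ℝ, ℝ) ∞ g (p.1 : ℝ) := by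
      rw [← ContMDiffAt.subtypeVal_comp_iff]
      refine contMDiffAt_id.congr_of_eventuallyEq ?_
      filter_upwards [isOpen_Ioo.mem_nhds p.1.2] with y hy
      simp only [Function.comp_apply, g, dif_pos hy, id]
    have hval := (contMDiff_subtype_val (n := 1) (I := 𝓘(ℝ, ℝ)) (U := UnitIoo)).mdifferentiableAt
      (x := p.1) one_ne_zero
    have hcomp := mfderiv_comp p.1 (hg.mdifferentiableAt (by simp)) hval
    have hid : g ∘ (Subtype.val : UnitIoo → ℝ) = id := by
      funext y
      exact dif_pos y.2
    rw [hid, mfderiv_id] at hcomp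
    intro v w hvw
    have hv := congrArg (fun L ↦ L v) hcomp
    have hw := congrArg (fun L ↦ L w) hcomp
    exact (hv.trans (congrArg (mfderiv 𝓘(ℝ, ℝ) 𝓘(ℝ, ℝ) g (p.1 : ℝ)) hvw)).trans hw.symm
  have h2 : Function.Injective
      (mfderiv (𝓡 1) 𝓘(ℝ, ℂ) (fun z : Circle ↦ (z : ℂ)) p.2) := by
    have : Fact (Module.finrank ℝ ℂ = 1 + 1) := finrank_real_complex_fact'
    exact injective_mvfderiv_subtypeVal_sphere (E := ℂ) (n := 1) p.2
  rw [modelWithCornersSelf_prod, ← chartedSpaceSelf_prod]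
  have := mfderiv_prodMap (p := p)
    ((contMDiff_subtype_val (n := ∞) (I := 𝓘(ℝ, ℝ)) (U := UnitIoo)).mdifferentiableAt (x := p.1) (by simp))
    (contMDiff_circle_coe.mdifferentiableAt (x := p.2) (by simp))
  unfold revCoord
  rw [this]
  exact h1.prodMap h2

theorem contMDiff_revEmbedding (r : ℝ → ℝ) (hr : ContDiff ℝ ∞ r) :
    ContMDiff revModel 𝓘(ℝ, EuclideanSpace ℝ (Fin 3)) ∞ (revEmbedding r) := by
  have hG : ContDiff ℝ ∞ (fun y : ℝ × ℂ ↦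
      (!₂[y.1, r y.1 * y.2.re, r y.1 * y.2.im] : EuclideanSpace ℝ (Fin 3))) := by
    have hre : ContDiff ℝ ∞ (fun y : ℝ × ℂ ↦ y.2.re) := Complex.reCLM.contDiff.comp contDiff_snd
    have him : ContDiff ℝ ∞ (fun y : ℝ × ℂ ↦ y.2.im) := Complex.imCLM.contDiff.comp contDiff_snd
    have hr1 : ContDiff ℝ ∞ (fun y : ℝ × ℂ ↦ r y.1) := hr.comp contDiff_fst
    rw [contDiff_euclidean]
    intro i
    fin_cases i
    · exact contDiff_fst
    · exact hr1.mul hre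
    · exact hr1.mul him
  exact hG.contMDiff.comp contMDiff_revCoord

theorem mfderiv_revEmbedding_injective (r : ℝ → ℝ) (hr : ContDiff ℝ ∞ r)
    (hpos : ∀ x ∈ Ioo (0 : ℝ) 1, 0 < r x) (p : RevSurface) :
    Function.Injective (mfderiv revModel 𝓘(ℝ, EuclideanSpace ℝ (Fin 3)) (revEmbedding r) p) := by
  let K : EuclideanSpace ℝ (Fin 3) → ℝ × ℂ := fun y ↦
    (y 0, (r (y 0))⁻¹ • ((y 1 : ℂ) + (y 2 : ℂ) * Complex.I))
  have hp : r (revEmbedding r p 0) ≠ 0 := (hpos _ p.1.2).ne'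
  have hK : DifferentiableAt ℝ K (revEmbedding r p) := by
    have hc : ∀ i : Fin 3, DifferentiableAt ℝ (fun y : EuclideanSpace ℝ (Fin 3) ↦ y i)
        (revEmbedding r p) := fun i ↦
      (EuclideanSpace.proj i : EuclideanSpace ℝ (Fin 3) →L[ℝ] ℝ).differentiableAt
    have hcc : ∀ i : Fin 3, DifferentiableAt ℝ (fun y : EuclideanSpace ℝ (Fin 3) ↦ (y i : ℂ))
        (revEmbedding r p) := fun i ↦ Complex.ofRealCLM.differentiableAt.comp _ (hc i)
    have hr0 : DifferentiableAt ℝ (fun y : EuclideanSpace ℝ (Fin 3) ↦ r (y 0))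
        (revEmbedding r p) :=
      ((hr.differentiable (by simp)).differentiableAt).comp (revEmbedding r p) (hc 0)
    exact (hc 0).prodMk ((hr0.inv hp).smul ((hcc 1).add ((hcc 2).mul_const _)))
  have hid : K ∘ revEmbedding r = revCoord := by
    funext q
    have hq : r q.1 ≠ 0 := (hpos _ q.1.2).ne'
    refine Prod.ext rfl (Complex.ext ?_ ?_) <;> simp [K, revEmbedding, revCoord, hq]
  have hcomp := mfderiv_comp p hK.mdifferentiableAt
    ((contMDiff_revEmbedding r hr).mdifferentiableAt (x := p) (by simp))
  rw [hid] at hcomp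
  intro v w hvw
  apply mfderiv_revCoord_injective p
  rw [hcomp]
  exact congrArg (mfderiv 𝓘(ℝ, EuclideanSpace ℝ (Fin 3)) 𝓘(ℝ, ℝ × ℂ) K (revEmbedding r p)) hvw

/-- The Riemannian metric `k` on the surface of revolution, i.e. the metric induced by the Euclidean
metric of `ℝ³`. In the coordinates `(x, φ)` it is `(1 + r'(x)^2) dx^2 + r(x)^2 dφ^2`. -/
def revMetric (r : ℝ → ℝ) (hr : ContDiff ℝ ∞ r) (hpos : ∀ x ∈ Ioo (0 : ℝ) 1, 0 < r x) :
    ContMDiffRiemannianMetric revModel ∞ (ℝ × EuclideanSpace ℝ (Fin 1))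
      (fun p : RevSurface ↦ TangentSpace revModel p) where
  inner := FormField.pullback revModel 𝓘(ℝ, EuclideanSpace ℝ (Fin 3)) (revEmbedding r)
    (euclideanForm (EuclideanSpace ℝ (Fin 3)))
  symm p v w := (riemannianMetricVectorSpace (EuclideanSpace ℝ (Fin 3))).symm
    (revEmbedding r p) _ _
  pos p v hv := by
    have hne : mfderiv revModel 𝓘(ℝ, EuclideanSpace ℝ (Fin 3)) (revEmbedding r) p v ≠ 0 := by
      intro h
      apply hv
      apply mfderiv_revEmbedding_injective r hr hpos p
      rw [map_zero]
      exact h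
    exact (riemannianMetricVectorSpace (EuclideanSpace ℝ (Fin 3))).pos _ _ hne
  isVonNBounded p := by
    let A : (ℝ × EuclideanSpace ℝ (Fin 1)) →L[ℝ] EuclideanSpace ℝ (Fin 3) :=
      mfderiv revModel 𝓘(ℝ, EuclideanSpace ℝ (Fin 3)) (revEmbedding r) p
    have hA : Function.Injective A := mfderiv_revEmbedding_injective r hr hpos p
    obtain ⟨K, -, hK⟩ := A.toLinearMap.exists_antilipschitzWith
      (LinearMap.ker_eq_bot.2 hA)
    change Bornology.IsVonNBounded ℝ
      {v : ℝ × EuclideanSpace ℝ (Fin 1) | inner ℝ (A v) (A v) < 1}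
    refine (NormedSpace.isVonNBounded_closedBall ℝ (ℝ × EuclideanSpace ℝ (Fin 1)) K).subset ?_
    intro v hv
    have h1 : ‖A v‖ < 1 := by
      have : inner ℝ (A v) (A v) < 1 := hv
      rw [real_inner_self_eq_norm_sq] at this
      nlinarith [norm_nonneg (A v)]
    have h2 := hK.le_mul_dist v 0
    have h3 : ‖v‖ ≤ K * ‖A v‖ := by simpa [dist_zero_right] using h2
    rw [mem_closedBall_zero_iff]
    nlinarith [K.coe_nonneg]
  contMDiff := (euclideanForm_isSmooth _).pullback (contMDiff_revEmbedding r hr)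

/-- The distance `dist_k` on the surface of revolution: the infimum of the `k`-lengths of the `C^1`
curves from `p` to `q`. -/
def revEDist (r : ℝ → ℝ) (hr : ContDiff ℝ ∞ r) (hpos : ∀ x ∈ Ioo (0 : ℝ) 1, 0 < r x)
    (p q : RevSurface) : ENNReal :=
  letI : RiemannianBundle (fun p : RevSurface ↦ TangentSpace revModel p) :=
    ⟨(revMetric r hr hpos).toRiemannianMetric⟩
  riemannianEDist revModel p q

/-- The model of the three-dimensional manifold `ℝ × Σ`. -/
abbrev staticModel : ModelWithCorners ℝ (ℝ × (ℝ × EuclideanSpace ℝ (Fin 1)))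
    (ModelProd ℝ (ModelProd ℝ (EuclideanSpace ℝ (Fin 1)))) := 𝓘(ℝ, ℝ).prod revModel

/-- The Lorentzian metric `-dt^2 + k` on `ℝ × Σ`: minus the pullback of the standard metric of `ℝ`
plus the pullback of `k`. -/
def staticMetric (r : ℝ → ℝ) (hr : ContDiff ℝ ∞ r) (hpos : ∀ x ∈ Ioo (0 : ℝ) 1, 0 < r x) :
    FormField staticModel (ℝ × RevSurface) :=
  -FormField.pullback staticModel 𝓘(ℝ, ℝ) Prod.fst (euclideanForm ℝ) +
    FormField.pullback staticModel revModel Prod.snd (revMetric r hr hpos).inner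

theorem staticMetric_apply (r : ℝ → ℝ) (hr : ContDiff ℝ ∞ r)
    (hpos : ∀ x ∈ Ioo (0 : ℝ) 1, 0 < r x) (x : ℝ × RevSurface)
    (v w : ℝ × (ℝ × EuclideanSpace ℝ (Fin 1))) :
    staticMetric r hr hpos x v w = -(v.1 * w.1) + (revMetric r hr hpos).inner x.2 v.2 w.2 := by
  have h : staticMetric r hr hpos x v w =
      -(euclideanForm ℝ x.1 (mfderiv staticModel 𝓘(ℝ, ℝ) Prod.fst x v)
        (mfderiv staticModel 𝓘(ℝ, ℝ) Prod.fst x w)) +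
      (revMetric r hr hpos).inner x.2 (mfderiv staticModel revModel Prod.snd x v)
        (mfderiv staticModel revModel Prod.snd x w) := rfl
  rw [h, mfderiv_fst, mfderiv_snd]
  congr 2
  exact mul_comm _ _

/-- The spacetime `(ℝ × Σ, -dt^2 + k)`, time-oriented by `∂_t`. -/
def staticSpacetime (r : ℝ → ℝ) (hr : ContDiff ℝ ∞ r) (hpos : ∀ x ∈ Ioo (0 : ℝ) 1, 0 < r x) :
    Spacetime staticModel (ℝ × RevSurface) where
  metric := staticMetric r hr hpos
  isSmooth := ((euclideanForm_isSmooth ℝ).pullback contMDiff_fst).neg.add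
    (FormField.IsSmooth.pullback (revMetric r hr hpos).contMDiff contMDiff_snd)
  symm x v w := by
    refine (staticMetric_apply r hr hpos x v w).trans
      (Eq.trans ?_ (staticMetric_apply r hr hpos x w v).symm)
    exact congrArg₂ (fun a b : ℝ ↦ -a + b) (mul_comm _ _) ((revMetric r hr hpos).symm x.2 _ _)
  timeField x := ((1 : ℝ), (0 : ℝ × EuclideanSpace ℝ (Fin 1)))
  continuous_timeField := by
    have h := contMDiff_equivTangentBundleProd_symm (n := 0) (I := 𝓘(ℝ, ℝ)) (I' := revModel)
      (M := ℝ) (M' := RevSurface)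
    have h1 : Continuous (fun x : ℝ ↦ (⟨x, (1 : ℝ)⟩ : TangentBundle 𝓘(ℝ, ℝ) ℝ)) := by
      exact (tangentBundleModelSpaceHomeomorph 𝓘(ℝ, ℝ)).symm.continuous.comp
        (continuous_id.prodMk continuous_const)
    have h2 : Continuous (fun x : RevSurface ↦ (⟨x, 0⟩ : TangentBundle revModel RevSurface)) :=
      (Bundle.contMDiff_zeroSection (n := 0) (IB := revModel) ℝ
        (TangentSpace revModel : RevSurface → Type _)).continuous
    exact h.continuous.comp ((h1.comp continuous_fst).prodMk (h2.comp continuous_snd))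
  timelike x := by
    refine (staticMetric_apply r hr hpos x (1, 0) (1, 0)).trans_lt ?_
    have h0 : (revMetric r hr hpos).inner x.2 0 0 = 0 := map_zero _
    change -((1 : ℝ) * 1) + (revMetric r hr hpos).inner x.2 0 0 < 0
    rw [h0]
    norm_num
  pos x v hv h := by
    obtain ⟨a, u⟩ := (v : ℝ × (ℝ × EuclideanSpace ℝ (Fin 1)))
    have h' := (staticMetric_apply r hr hpos x (1, 0) (a, u)).symm.trans h
    have h0 : (revMetric r hr hpos).inner x.2 0 = 0 := map_zero _
    have ha : a = 0 := by
      have h1 : (revMetric r hr hpos).inner x.2 0 u = 0 := congrArg (fun L ↦ L u) h0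
      change -((1 : ℝ) * a) + (revMetric r hr hpos).inner x.2 0 u = 0 at h'
      rw [h1] at h'
      linarith
    subst ha
    have hu : u ≠ 0 := fun hu ↦ hv (by rw [hu]; rfl)
    refine lt_of_lt_of_eq ?_ (staticMetric_apply r hr hpos x (0, u) (0, u)).symm
    change 0 < -((0 : ℝ) * 0) + (revMetric r hr hpos).inner x.2 u u
    have := (revMetric r hr hpos).pos x.2 u hu
    linarith

end Surface

end

/-!
Near an end of `(0, 1)` the slope condition gives latitudes `l` whose circles have length
`2πr(l) < l`, so a curve that dips to `l / 2` beyond such a latitude is beaten by following its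
circle instead. Hence almost shortest curves between two fixed points stay in a compact part of the
surface. Parametrized by almost constant speed they almost minimize the energy, so they satisfy the
integrated Euler–Lagrange equation (du Bois-Reymond) up to an error which tends to `0` in `L²`.
Along a subsequence the momenta therefore converge almost everywhere, and since the Legendre map is
injective so do the velocities; the limit is a `C¹` curve of speed at most `dist_k`. Lifted to the
spacetime it is a causal curve, so that `J⁺` is the set `{τ - σ ≥ dist_k}`, which is closed because
`dist_k` is continuous.
-/

noncomputable section

open Filter MeasureTheory Topology

section Calculus

theorem hasDerivAt_add_integral {E : Type*} [NormedAddCommGroup E] [NormedSpace ℝ E]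
    [CompleteSpace E] {f : ℝ → E} (hf : Continuous f) (c : E) (t : ℝ) :
    HasDerivAt (fun t ↦ c + ∫ s in (0 : ℝ)..t, f s) (f t) t :=
  (hf.integral_hasStrictDerivAt 0 t).hasDerivAt.const_add c

theorem contDiff_add_integral {E : Type*} [NormedAddCommGroup E] [NormedSpace ℝ E]
    [CompleteSpace E] {f : ℝ → E} (hf : Continuous f) (c : E) :
    ContDiff ℝ 1 (fun t ↦ c + ∫ s in (0 : ℝ)..t, f s) := by
  have hderiv := hasDerivAt_add_integral hf c
  refine contDiff_one_iff_deriv.2 ⟨fun t ↦ (hderiv t).differentiableAt, ?_⟩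
  rwa [show deriv (fun t ↦ c + ∫ s in (0 : ℝ)..t, f s) = f from funext fun t ↦ (hderiv t).deriv]

theorem sq_integral_le_integral_sq {f : ℝ → ℝ} (hf : Continuous f) :
    (∫ t in (0 : ℝ)..1, f t) ^ 2 ≤ ∫ t in (0 : ℝ)..1, f t ^ 2 := by
  set m := ∫ t in (0 : ℝ)..1, f t with hm
  have hnonneg : 0 ≤ ∫ t in (0 : ℝ)..1, (f t - m) ^ 2 :=
    intervalIntegral.integral_nonneg zero_le_one fun _ _ ↦ sq_nonneg _
  have hexpand : ∫ t in (0 : ℝ)..1, (f t - m) ^ 2 = (∫ t in (0 : ℝ)..1, f t ^ 2) - m ^ 2 := by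
    calc ∫ t in (0 : ℝ)..1, (f t - m) ^ 2
        = ∫ t in (0 : ℝ)..1, (f t ^ 2 - (2 * m) * f t + m ^ 2) := by
          congr 1; ext t; ring
      _ = (∫ t in (0 : ℝ)..1, f t ^ 2) - 2 * m * m + m ^ 2 := by
          rw [intervalIntegral.integral_add
              (by exact Continuous.intervalIntegrable (by fun_prop) _ _) (by simp),
            intervalIntegral.integral_sub (by exact Continuous.intervalIntegrable (by fun_prop) _ _)
              (by exact Continuous.intervalIntegrable (by fun_prop) _ _),
            intervalIntegral.integral_const_mul, ← hm]
          simp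
      _ = (∫ t in (0 : ℝ)..1, f t ^ 2) - m ^ 2 := by ring
  linarith

theorem surjective_integral_of_le {f : ℝ → ℝ} (hf : Continuous f) {ε : ℝ} (hε : 0 < ε)
    (hle : ∀ t, ε ≤ f t) : Function.Surjective fun t ↦ ∫ s in (0 : ℝ)..t, f s := by
  have hbound : ∀ {a b : ℝ}, a ≤ b → ε * (b - a) ≤ ∫ s in a..b, f s := fun {a b} hab ↦ by
    calc ε * (b - a) = ∫ _ in a..b, ε := by simp [mul_comm]
      _ ≤ ∫ s in a..b, f s :=
        intervalIntegral.integral_mono_on hab (by simp) (hf.intervalIntegrable _ _)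
          fun s _ ↦ hle s
  refine (intervalIntegral.continuous_primitive (fun _ _ ↦ hf.intervalIntegrable _ _) 0).surjective
    ?_ ?_
  · refine tendsto_atTop_mono' atTop ?_ (tendsto_id.const_mul_atTop hε)
    filter_upwards [eventually_ge_atTop 0] with t ht
    simpa using hbound ht
  · refine tendsto_atBot_mono' atBot ?_ (tendsto_id.const_mul_atBot hε)
    filter_upwards [eventually_le_atBot 0] with t ht
    rw [intervalIntegral.integral_symm, id, neg_le]
    simpa using hbound ht

theorem exists_contDiff_inverse_integral {f : ℝ → ℝ} (hf : Continuous f) {ε : ℝ} (hε : 0 < ε)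
    (hle : ∀ t, ε ≤ f t) :
    ∃ τ : ℝ → ℝ, ContDiff ℝ 1 τ ∧ (∀ t, τ (∫ s in (0 : ℝ)..t, f s) = t) ∧
      ∀ s, HasDerivAt τ (f (τ s))⁻¹ s := by
  set F : ℝ → ℝ := fun t ↦ ∫ s in (0 : ℝ)..t, f s
  have hF : ∀ t, HasDerivAt F (f t) t := fun t ↦ (hf.integral_hasStrictDerivAt 0 t).hasDerivAt
  have hne : ∀ t, f t ≠ 0 := fun t ↦ (hε.trans_le (hle t)).ne'
  have hmono : StrictMono F :=
    strictMono_of_deriv_pos fun t ↦ (hF t).deriv.symm ▸ hε.trans_le (hle t)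
  let e : ℝ ≃ₜ ℝ :=
    (hmono.orderIsoOfSurjective F (surjective_integral_of_le hf hε hle)).toHomeomorph
  have hF1 : ContDiff ℝ 1 F := by simpa [F] using contDiff_add_integral hf (0 : ℝ)
  have hsymm : ContDiff ℝ 1 e.symm := e.contDiff_symm_deriv hne hF hF1
  exact ⟨e.symm, hsymm, e.symm_apply_apply, fun s ↦ (hF (e.symm s)).of_local_left_inverse
    e.symm.continuous.continuousAt (hne _) (Eventually.of_forall e.apply_symm_apply)⟩

theorem exists_reparametrization {v : ℝ → ℝ} (hv : Continuous v) (hv0 : ∀ t, 0 ≤ v t) {c : ℝ}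
    (hc : ∫ t in (0 : ℝ)..1, v t < c) :
    ∃ τ : ℝ → ℝ, ContDiff ℝ 1 τ ∧ τ 0 = 0 ∧ τ 1 = 1 ∧
      ∀ s, 0 ≤ deriv τ s ∧ deriv τ s * v (τ s) ≤ c := by
  set ε := c - ∫ t in (0 : ℝ)..1, v t with hε
  have hε0 : 0 < ε := sub_pos.2 hc
  have hc0 : 0 < c := (intervalIntegral.integral_nonneg zero_le_one fun t _ ↦ hv0 t).trans_lt hc
  obtain ⟨τ, hτ, hinv, hderiv⟩ := exists_contDiff_inverse_integral (f := fun t ↦ (v t + ε) / c)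
    (by fun_prop) (div_pos hε0 hc0) fun t ↦ by gcongr; linarith [hv0 t]
  have htotal : ∫ t in (0 : ℝ)..1, (v t + ε) / c = 1 := by
    rw [intervalIntegral.integral_div,
      intervalIntegral.integral_add (hv.intervalIntegrable _ _) (by simp)]
    simp [hε, hc0.ne']
  refine ⟨τ, hτ, by simpa using hinv 0, by simpa [htotal] using hinv 1, fun s ↦ ?_⟩
  have hpos : 0 < v (τ s) + ε := by linarith [hv0 (τ s)]
  rw [(hderiv s).deriv, inv_div]
  refine ⟨by positivity, ?_⟩
  rw [div_mul_eq_mul_div, div_le_iff₀ hpos]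
  nlinarith [hv0 (τ s)]

theorem eq_mul_cexp_integral {z f : ℝ → ℂ} (hf : Continuous f)
    (hz : ∀ t, HasDerivAt z (f t * z t) t) (t : ℝ) :
    z t = z 0 * Complex.exp (∫ s in (0 : ℝ)..t, f s) := by
  have hF : ∀ t, HasDerivAt (fun t ↦ ∫ s in (0 : ℝ)..t, f s) (f t) t := fun t ↦
    (hf.integral_hasStrictDerivAt 0 t).hasDerivAt
  have hconst : ∀ t, HasDerivAt
      (fun t ↦ z t * Complex.exp (-∫ s in (0 : ℝ)..t, f s)) 0 t := fun t ↦
    ((hz t).mul (hF t).neg.cexp).congr_deriv (by ring)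
  have h := is_const_of_deriv_eq_zero (fun t ↦ (hconst t).differentiableAt)
    (fun t ↦ (hconst t).deriv) t 0
  rw [Complex.exp_neg, mul_inv_eq_iff_eq_mul₀ (Complex.exp_ne_zero _)] at h
  simpa using h

theorem exists_lift_circle {z : ℝ → Circle} (hz : ContDiff ℝ 1 fun t ↦ (z t : ℂ)) {φ₀ : ℝ}
    (h₀ : Circle.exp φ₀ = z 0) :
    ∃ φ : ℝ → ℝ, ContDiff ℝ 1 φ ∧ φ 0 = φ₀ ∧ ∀ t, Circle.exp (φ t) = z t := by
  set Z : ℝ → ℂ := fun t ↦ (z t : ℂ)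
  set f : ℝ → ℂ := fun t ↦ deriv Z t / Z t
  have hf : Continuous f :=
    (hz.continuous_deriv le_rfl).div₀ hz.continuous fun t ↦ Circle.coe_ne_zero _
  have hexp : ∀ t, Z t = Z 0 * Complex.exp (∫ s in (0 : ℝ)..t, f s) :=
    eq_mul_cexp_integral hf fun t ↦ by
      rw [div_mul_cancel₀ _ (Circle.coe_ne_zero _)]
      exact (hz.differentiable one_ne_zero t).hasDerivAt
  have hre : ∀ t, (∫ s in (0 : ℝ)..t, f s).re = 0 := fun t ↦ by
    simpa [Z, Complex.norm_exp, Circle.norm_coe] using (congrArg norm (hexp t)).symm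
  refine ⟨fun t ↦ φ₀ + (∫ s in (0 : ℝ)..t, f s).im, contDiff_const.add
    (Complex.imCLM.contDiff.comp (by simpa using contDiff_add_integral hf 0)), by simp,
    fun t ↦ Circle.ext ?_⟩
  have him : ∫ s in (0 : ℝ)..t, f s = (∫ s in (0 : ℝ)..t, f s).im * Complex.I :=
    Complex.ext (by simpa using hre t) (by simp)
  calc (Circle.exp (φ₀ + (∫ s in (0 : ℝ)..t, f s).im) : ℂ)
      = Circle.exp φ₀ * Complex.exp ((∫ s in (0 : ℝ)..t, f s).im * Complex.I) := by
        rw [Circle.exp_add, Circle.coe_mul, Circle.coe_exp ((∫ s in (0 : ℝ)..t, f s).im)]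
    _ = Z t := by rw [← him, h₀, hexp t]

end Calculus

section Variation

theorem exists_taylor_bound {E : Type*} [NormedAddCommGroup E] [NormedSpace ℝ E] [ProperSpace E]
    {f : E → ℝ} (hf : ContDiff ℝ 2 f) {K : Set E} (hK : IsCompact K) :
    ∃ M, 0 ≤ M ∧ ∀ z ∈ K, ∀ h, ‖h‖ ≤ 1 → f (z + h) ≤ f z + fderiv ℝ f z h + M * ‖h‖ ^ 2 := by
  have hf' : ContDiff ℝ 1 (fderiv ℝ f) := hf.fderiv_right (by norm_num)
  obtain ⟨M, hM⟩ := (hK.cthickening (r := 1)).exists_bound_of_continuousOn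
    (hf'.continuous_fderiv one_ne_zero).continuousOn
  refine ⟨max M 0, le_max_right _ _, fun z hz h hh ↦ ?_⟩
  have hball : ∀ y ∈ Metric.closedBall z ‖h‖, ‖fderiv ℝ f y - fderiv ℝ f z‖ ≤ max M 0 * ‖h‖ := by
    intro y hy
    refine ((convex_closedBall z ‖h‖).norm_image_sub_le_of_norm_fderiv_le (C := max M 0)
      (fun w _ ↦ hf'.differentiable one_ne_zero w) (fun w hw ↦ ?_)
      (Metric.mem_closedBall_self (norm_nonneg h)) hy).trans ?_
    · exact (hM w (Metric.mem_cthickening_of_dist_le w z 1 K hz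
        ((Metric.mem_closedBall.1 hw).trans hh))).trans (le_max_left _ _)
    · gcongr
      exact mem_closedBall_iff_norm.1 hy
  have htaylor := (convex_closedBall z ‖h‖).norm_image_sub_le_of_norm_fderiv_le' (y := z + h)
    (fun w _ ↦ hf.differentiable two_ne_zero w) hball (Metric.mem_closedBall_self (norm_nonneg h))
    (by simp)
  rw [add_sub_cancel_left, Real.norm_eq_abs] at htaylor
  linarith [le_abs_self (f (z + h) - f z - fderiv ℝ f z h)]

variable {E : Type*} [NormedAddCommGroup E] [NormedSpace ℝ E]

/-- The action `∫₀¹ Λ(u, u') dt` of a curve `u` for the autonomous Lagrangian `Λ`. -/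
def action (Λ : E × E → ℝ) (u : ℝ → E) : ℝ := ∫ t in (0 : ℝ)..1, Λ (u t, deriv u t)

/-- The Legendre map `(y, w) ↦ (y, ∂Λ/∂w)` of a Lagrangian. -/
def legendreMap (Λ : E × E → ℝ) (z : E × E) : E × (E →L[ℝ] ℝ) :=
  (z.1, (fderiv ℝ Λ z).comp (.inr ℝ E E))

/-- The momentum `∂Λ/∂w (u, u')` along the curve `u`. -/
def momentum (Λ : E × E → ℝ) (u : ℝ → E) (t : ℝ) : E →L[ℝ] ℝ :=
  (legendreMap Λ (u t, deriv u t)).2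

/-- The force `∂Λ/∂y (u, u')` along the curve `u`. -/
def force (Λ : E × E → ℝ) (u : ℝ → E) (t : ℝ) : E →L[ℝ] ℝ :=
  (fderiv ℝ Λ (u t, deriv u t)).comp (.inl ℝ E E)

/-- The momentum minus the integrated force. By du Bois-Reymond's form of the Euler-Lagrange
equation, it is constant along a critical curve of the action. -/
def momentumSubImpulse (Λ : E × E → ℝ) (u : ℝ → E) (t : ℝ) : E →L[ℝ] ℝ :=
  momentum Λ u t - ∫ s in (0 : ℝ)..t, force Λ u s

/-- The deviation of `momentumSubImpulse` from its mean value: it vanishes along a critical curve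
of the action, and measures how far `u` is from satisfying the Euler-Lagrange equation. -/
def eulerLagrangeDefect (Λ : E × E → ℝ) (u : ℝ → E) (t : ℝ) : E →L[ℝ] ℝ :=
  momentumSubImpulse Λ u t - ∫ s in (0 : ℝ)..1, momentumSubImpulse Λ u s

/-- The curve `u` minimizes the action, up to an error `κ`, among the `C¹` curves with the same
endpoints whose distance from `u` is at most `ρ`. -/
def IsAlmostMinimizing (Λ : E × E → ℝ) (ρ κ : ℝ) (u : ℝ → E) : Prop :=
  ∀ ξ : ℝ → E, ContDiff ℝ 1 ξ → ξ 0 = 0 → ξ 1 = 0 → (∀ t ∈ Icc (0 : ℝ) 1, ‖ξ t‖ ≤ ρ) →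
    action Λ u ≤ action Λ (u + ξ) + κ

variable {Λ : E × E → ℝ} {u : ℝ → E}

theorem fderiv_lagrangian_apply (t : ℝ) (v w : E) :
    fderiv ℝ Λ (u t, deriv u t) (v, w) = force Λ u t v + momentum Λ u t w := by
  simp [force, momentum, legendreMap, ← map_add]

theorem continuous_lagrangian (hΛ : Continuous Λ) (hu : ContDiff ℝ 1 u) :
    Continuous fun t ↦ Λ (u t, deriv u t) :=
  hΛ.comp (hu.continuous.prodMk (hu.continuous_deriv le_rfl))

theorem continuous_legendreMap (hΛ : ContDiff ℝ 1 Λ) : Continuous (legendreMap Λ) :=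
  continuous_fst.prodMk ((hΛ.continuous_fderiv one_ne_zero).clm_comp continuous_const)

theorem continuous_momentum (hΛ : ContDiff ℝ 1 Λ) (hu : ContDiff ℝ 1 u) :
    Continuous (momentum Λ u) :=
  ((continuous_legendreMap hΛ).comp (hu.continuous.prodMk (hu.continuous_deriv le_rfl))).snd

theorem continuous_force (hΛ : ContDiff ℝ 1 Λ) (hu : ContDiff ℝ 1 u) : Continuous (force Λ u) :=
  ((hΛ.continuous_fderiv one_ne_zero).comp
    (hu.continuous.prodMk (hu.continuous_deriv le_rfl))).clm_comp continuous_const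

theorem continuous_momentumSubImpulse (hΛ : ContDiff ℝ 1 Λ) (hu : ContDiff ℝ 1 u) :
    Continuous (momentumSubImpulse Λ u) :=
  (continuous_momentum hΛ hu).sub (intervalIntegral.continuous_primitive
    (fun _ _ ↦ (continuous_force hΛ hu).intervalIntegrable _ _) 0)

theorem continuous_eulerLagrangeDefect (hΛ : ContDiff ℝ 1 Λ) (hu : ContDiff ℝ 1 u) :
    Continuous (eulerLagrangeDefect Λ u) :=
  (continuous_momentumSubImpulse hΛ hu).sub continuous_const

theorem integral_eulerLagrangeDefect_apply (hΛ : ContDiff ℝ 1 Λ) (hu : ContDiff ℝ 1 u) (e : E) :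
    ∫ t in (0 : ℝ)..1, eulerLagrangeDefect Λ u t e = 0 := by
  have hW : Continuous fun t ↦ momentumSubImpulse Λ u t e :=
    (continuous_momentumSubImpulse hΛ hu).clm_apply continuous_const
  simp only [eulerLagrangeDefect, sub_apply]
  rw [intervalIntegral.integral_sub (hW.intervalIntegrable _ _) (by simp),
    ContinuousLinearMap.intervalIntegral_apply
      ((continuous_momentumSubImpulse hΛ hu).intervalIntegrable _ _)]
  simp

theorem hasDerivAt_momentum_sub_defect (hΛ : ContDiff ℝ 1 Λ) (hu : ContDiff ℝ 1 u) (t : ℝ) :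
    HasDerivAt (fun t ↦ momentum Λ u t - eulerLagrangeDefect Λ u t) (force Λ u t) t := by
  refine (hasDerivAt_add_integral (continuous_force hΛ hu)
    (∫ s in (0 : ℝ)..1, momentumSubImpulse Λ u s) t).congr_of_eventuallyEq
    (Eventually.of_forall fun s ↦ ?_)
  simp only [eulerLagrangeDefect, momentumSubImpulse]
  abel

section Bounds

variable {B : ℝ} (hB : ∀ t ∈ Icc (0 : ℝ) 1, ‖fderiv ℝ Λ (u t, deriv u t)‖ ≤ B)
include hB

theorem norm_momentum_le {t : ℝ} (ht : t ∈ Icc (0 : ℝ) 1) : ‖momentum Λ u t‖ ≤ B :=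
  calc ‖momentum Λ u t‖ ≤ ‖fderiv ℝ Λ (u t, deriv u t)‖ * ‖ContinuousLinearMap.inr ℝ E E‖ :=
        ContinuousLinearMap.opNorm_comp_le _ _
    _ ≤ ‖fderiv ℝ Λ (u t, deriv u t)‖ * 1 := by
        gcongr; exact ContinuousLinearMap.norm_inr_le_one ℝ E E
    _ ≤ B := by rw [mul_one]; exact hB t ht

theorem norm_force_le {t : ℝ} (ht : t ∈ Icc (0 : ℝ) 1) : ‖force Λ u t‖ ≤ B :=
  calc ‖force Λ u t‖ ≤ ‖fderiv ℝ Λ (u t, deriv u t)‖ * ‖ContinuousLinearMap.inl ℝ E E‖ :=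
        ContinuousLinearMap.opNorm_comp_le _ _
    _ ≤ ‖fderiv ℝ Λ (u t, deriv u t)‖ * 1 := by
        gcongr; exact ContinuousLinearMap.norm_inl_le_one ℝ E E
    _ ≤ B := by rw [mul_one]; exact hB t ht

theorem norm_momentumSubImpulse_le {t : ℝ} (ht : t ∈ Icc (0 : ℝ) 1) :
    ‖momentumSubImpulse Λ u t‖ ≤ 2 * B := by
  have hB0 : 0 ≤ B := (norm_nonneg _).trans (hB t ht)
  have himpulse : ‖∫ s in (0 : ℝ)..t, force Λ u s‖ ≤ B * |t - 0| :=
    intervalIntegral.norm_integral_le_of_norm_le_const fun s hs ↦ by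
      rw [uIoc_of_le ht.1] at hs
      exact norm_force_le hB ⟨hs.1.le, hs.2.trans ht.2⟩
  rw [sub_zero, abs_of_nonneg ht.1] at himpulse
  calc ‖momentumSubImpulse Λ u t‖ ≤ ‖momentum Λ u t‖ + ‖∫ s in (0 : ℝ)..t, force Λ u s‖ :=
        norm_sub_le _ _
    _ ≤ B + B * t := add_le_add (norm_momentum_le hB ht) himpulse
    _ ≤ 2 * B := by nlinarith [ht.2]

theorem norm_eulerLagrangeDefect_le {t : ℝ} (ht : t ∈ Icc (0 : ℝ) 1) :
    ‖eulerLagrangeDefect Λ u t‖ ≤ 4 * B := by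
  have hmean : ‖∫ s in (0 : ℝ)..1, momentumSubImpulse Λ u s‖ ≤ 2 * B * |1 - 0| :=
    intervalIntegral.norm_integral_le_of_norm_le_const fun s hs ↦ by
      rw [uIoc_of_le zero_le_one] at hs
      exact norm_momentumSubImpulse_le hB (Ioc_subset_Icc_self hs)
  calc ‖eulerLagrangeDefect Λ u t‖
      ≤ ‖momentumSubImpulse Λ u t‖ + ‖∫ s in (0 : ℝ)..1, momentumSubImpulse Λ u s‖ :=
        norm_sub_le _ _
    _ ≤ 2 * B + 2 * B * |1 - 0| := add_le_add (norm_momentumSubImpulse_le hB ht) hmean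
    _ = 4 * B := by norm_num; ring

end Bounds

/-- The variation field along the direction `e` whose derivative is the Euler-Lagrange defect in
this direction. -/
def defectVariation (Λ : E × E → ℝ) (u : ℝ → E) (e : E) (t : ℝ) : E :=
  (∫ s in (0 : ℝ)..t, eulerLagrangeDefect Λ u s e) • e

theorem defectVariation_zero (e : E) : defectVariation Λ u e 0 = 0 := by
  simp [defectVariation]

theorem defectVariation_one (hΛ : ContDiff ℝ 1 Λ) (hu : ContDiff ℝ 1 u) (e : E) :
    defectVariation Λ u e 1 = 0 := by
  rw [defectVariation, integral_eulerLagrangeDefect_apply hΛ hu, zero_smul]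

theorem hasDerivAt_defectVariation (hΛ : ContDiff ℝ 1 Λ) (hu : ContDiff ℝ 1 u) (e : E) (t : ℝ) :
    HasDerivAt (defectVariation Λ u e) (eulerLagrangeDefect Λ u t e • e) t :=
  (((continuous_eulerLagrangeDefect hΛ hu).clm_apply
    continuous_const).integral_hasStrictDerivAt 0 t).hasDerivAt.smul_const e

theorem contDiff_defectVariation (hΛ : ContDiff ℝ 1 Λ) (hu : ContDiff ℝ 1 u) (e : E) :
    ContDiff ℝ 1 (defectVariation Λ u e) := by
  have h := contDiff_add_integral ((continuous_eulerLagrangeDefect hΛ hu).clm_apply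
    (continuous_const (y := e))) 0
  simp only [zero_add] at h
  exact h.smul contDiff_const

theorem norm_defectVariation_le {C : ℝ} (hC : ∀ t ∈ Icc (0 : ℝ) 1, ‖eulerLagrangeDefect Λ u t‖ ≤ C)
    (e : E) {t : ℝ} (ht : t ∈ Icc (0 : ℝ) 1) : ‖defectVariation Λ u e t‖ ≤ C * ‖e‖ ^ 2 := by
  have hC0 : 0 ≤ C := (norm_nonneg _).trans (hC t ht)
  have hint : ‖∫ s in (0 : ℝ)..t, eulerLagrangeDefect Λ u s e‖ ≤ C * ‖e‖ * |t - 0| :=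
    intervalIntegral.norm_integral_le_of_norm_le_const fun s hs ↦ by
      rw [uIoc_of_le ht.1] at hs
      exact (eulerLagrangeDefect Λ u s).le_of_opNorm_le (hC s ⟨hs.1.le, hs.2.trans ht.2⟩) e
  rw [sub_zero, abs_of_nonneg ht.1] at hint
  calc ‖defectVariation Λ u e t‖ = ‖∫ s in (0 : ℝ)..t, eulerLagrangeDefect Λ u s e‖ * ‖e‖ :=
        norm_smul _ _
    _ ≤ C * ‖e‖ * 1 * ‖e‖ := by
        gcongr
        exact hint.trans (by gcongr; exact ht.2)
    _ = C * ‖e‖ ^ 2 := by ring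

theorem norm_eulerLagrangeDefect_smul_le {C : ℝ}
    {t : ℝ} (hC : ‖eulerLagrangeDefect Λ u t‖ ≤ C) (e : E) :
    ‖eulerLagrangeDefect Λ u t e • e‖ ≤ C * ‖e‖ ^ 2 :=
  calc ‖eulerLagrangeDefect Λ u t e • e‖ = ‖eulerLagrangeDefect Λ u t e‖ * ‖e‖ := norm_smul _ _
    _ ≤ C * ‖e‖ * ‖e‖ := by
        gcongr; exact (eulerLagrangeDefect Λ u t).le_of_opNorm_le hC e
    _ = C * ‖e‖ ^ 2 := by ring

theorem integral_fderiv_defectVariation (hΛ : ContDiff ℝ 1 Λ) (hu : ContDiff ℝ 1 u) (e : E) :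
    ∫ t in (0 : ℝ)..1, fderiv ℝ Λ (u t, deriv u t)
      (defectVariation Λ u e t, eulerLagrangeDefect Λ u t e • e) =
    ∫ t in (0 : ℝ)..1, (eulerLagrangeDefect Λ u t e) ^ 2 := by
  set D : ℝ → ℝ := fun t ↦ eulerLagrangeDefect Λ u t e
  set ζ : ℝ → ℝ := fun t ↦ ∫ s in (0 : ℝ)..t, D s
  set G : ℝ → ℝ := fun t ↦ (momentum Λ u t - eulerLagrangeDefect Λ u t) e
  have hD : Continuous D := (continuous_eulerLagrangeDefect hΛ hu).clm_apply continuous_const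
  have hF : Continuous fun t ↦ force Λ u t e :=
    (continuous_force hΛ hu).clm_apply continuous_const
  have hζ : ∀ t, HasDerivAt ζ (D t) t := fun t ↦ (hD.integral_hasStrictDerivAt 0 t).hasDerivAt
  have hG : ∀ t, HasDerivAt G (force Λ u t e) t := fun t ↦ by
    have h := (hasDerivAt_momentum_sub_defect hΛ hu t).clm_apply (hasDerivAt_const t e)
    rwa [map_zero, add_zero] at h
  have hζ1 : ζ 1 = 0 := integral_eulerLagrangeDefect_apply hΛ hu e
  have hparts : ∫ t in (0 : ℝ)..1, (force Λ u t e * ζ t + G t * D t) = 0 := by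
    rw [intervalIntegral.integral_deriv_mul_eq_sub (fun t _ ↦ hG t) (fun t _ ↦ hζ t)
      (hF.intervalIntegrable _ _) (hD.intervalIntegrable _ _), hζ1]
    simp [ζ]
  have hζc : Continuous ζ := continuous_iff_continuousAt.2 fun t ↦ (hζ t).continuousAt
  have hGc : Continuous G := continuous_iff_continuousAt.2 fun t ↦ (hG t).continuousAt
  calc _ = ∫ t in (0 : ℝ)..1, ((force Λ u t e * ζ t + G t * D t) + D t ^ 2) := by
        refine intervalIntegral.integral_congr fun t _ ↦ ?_
        simp only [fderiv_lagrangian_apply, defectVariation, map_smul, smul_eq_mul, sub_apply,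
          D, ζ, G]
        ring
    _ = ∫ t in (0 : ℝ)..1, D t ^ 2 := by
        rw [intervalIntegral.integral_add
          (by exact Continuous.intervalIntegrable (by fun_prop) _ _)
          (by exact Continuous.intervalIntegrable (by fun_prop) _ _), hparts, zero_add]

theorem action_add_le (hΛ : ContDiff ℝ 1 Λ) (hu : ContDiff ℝ 1 u) {ξ : ℝ → E}
    (hξ : ContDiff ℝ 1 ξ) {M S : ℝ} (hM0 : 0 ≤ M) (hM : ∀ t ∈ Icc (0 : ℝ) 1, ∀ h, ‖h‖ ≤ 1 →
      Λ ((u t, deriv u t) + h) ≤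
        Λ (u t, deriv u t) + fderiv ℝ Λ (u t, deriv u t) h + M * ‖h‖ ^ 2)
    (hS1 : S ≤ 1) (hS : ∀ t ∈ Icc (0 : ℝ) 1, ‖(ξ t, deriv ξ t)‖ ≤ S) :
    action Λ (u + ξ) ≤ action Λ u +
      (∫ t in (0 : ℝ)..1, fderiv ℝ Λ (u t, deriv u t) (ξ t, deriv ξ t)) + M * S ^ 2 := by
  have hderiv : deriv (u + ξ) = deriv u + deriv ξ := funext fun t ↦
    deriv_add (hu.differentiable one_ne_zero t) (hξ.differentiable one_ne_zero t)
  have hΛu := continuous_lagrangian hΛ.continuous hu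
  have hfirst : Continuous fun t ↦ fderiv ℝ Λ (u t, deriv u t) (ξ t, deriv ξ t) :=
    ((hΛ.continuous_fderiv one_ne_zero).comp
      (hu.continuous.prodMk (hu.continuous_deriv le_rfl))).clm_apply
      (hξ.continuous.prodMk (hξ.continuous_deriv le_rfl))
  have hpoint : ∀ t ∈ Icc (0 : ℝ) 1, Λ ((u + ξ) t, deriv (u + ξ) t) ≤
      Λ (u t, deriv u t) + fderiv ℝ Λ (u t, deriv u t) (ξ t, deriv ξ t) + M * S ^ 2 := by
    intro t ht
    rw [hderiv]
    refine (hM t ht (ξ t, deriv ξ t) ((hS t ht).trans hS1)).trans ?_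
    gcongr
    exact hS t ht
  calc action Λ (u + ξ) ≤ ∫ t in (0 : ℝ)..1,
          (Λ (u t, deriv u t) + fderiv ℝ Λ (u t, deriv u t) (ξ t, deriv ξ t) + M * S ^ 2) :=
        intervalIntegral.integral_mono_on zero_le_one
          ((continuous_lagrangian hΛ.continuous (hu.add hξ)).intervalIntegrable _ _)
          (((hΛu.add hfirst).add continuous_const).intervalIntegrable _ _) hpoint
    _ = _ := by
        rw [intervalIntegral.integral_add
            (by exact (hΛu.add hfirst).intervalIntegrable _ _) (by simp),
          intervalIntegral.integral_add (hΛu.intervalIntegrable _ _)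
            (hfirst.intervalIntegrable _ _)]
        simp [action]

theorem integral_sq_eulerLagrangeDefect_le (hΛ : ContDiff ℝ 1 Λ) (hu : ContDiff ℝ 1 u)
    {M C ρ κ : ℝ} (hM0 : 0 ≤ M) (hM : ∀ t ∈ Icc (0 : ℝ) 1, ∀ h, ‖h‖ ≤ 1 →
      Λ ((u t, deriv u t) + h) ≤
        Λ (u t, deriv u t) + fderiv ℝ Λ (u t, deriv u t) h + M * ‖h‖ ^ 2)
    (hC : ∀ t ∈ Icc (0 : ℝ) 1, ‖eulerLagrangeDefect Λ u t‖ ≤ C) (hκ : 0 < κ) {e : E}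
    (hκ1 : √κ * (C * ‖e‖ ^ 2) ≤ 1) (hκρ : √κ * (C * ‖e‖ ^ 2) ≤ ρ)
    (hmin : IsAlmostMinimizing Λ ρ κ u) :
    ∫ t in (0 : ℝ)..1, (eulerLagrangeDefect Λ u t e) ^ 2 ≤
      √κ * (1 + M * (C * ‖e‖ ^ 2) ^ 2) := by
  set η := defectVariation Λ u e
  set D := fun t ↦ eulerLagrangeDefect Λ u t e
  set R := C * ‖e‖ ^ 2
  have hηd := hasDerivAt_defectVariation hΛ hu e
  have hη : ContDiff ℝ 1 η := contDiff_defectVariation hΛ hu e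
  have hs : 0 < √κ := Real.sqrt_pos.2 hκ
  have hξ : ∀ t, ((-√κ • η) t, deriv (-√κ • η) t) = -√κ • (η t, D t • e) := fun t ↦ by
    rw [((hηd t).const_smul (-√κ)).deriv]; rfl
  have hnorm : ∀ t ∈ Icc (0 : ℝ) 1, ‖((-√κ • η) t, deriv (-√κ • η) t)‖ ≤ √κ * R := fun t ht ↦ by
    rw [hξ, norm_smul, norm_neg, Real.norm_of_nonneg hs.le]
    gcongr
    exact max_le (norm_defectVariation_le hC e ht) (norm_eulerLagrangeDefect_smul_le (hC t ht) e)
  have hfirst : ∫ t in (0 : ℝ)..1,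
      fderiv ℝ Λ (u t, deriv u t) ((-√κ • η) t, deriv (-√κ • η) t) =
        -√κ * ∫ t in (0 : ℝ)..1, D t ^ 2 := by
    simp only [hξ, map_smul, smul_eq_mul, intervalIntegral.integral_const_mul]
    rw [integral_fderiv_defectVariation hΛ hu]
  have hvar := action_add_le (ξ := -√κ • η) hΛ hu (hη.const_smul (-√κ)) hM0 hM hκ1 hnorm
  have hle := hmin (-√κ • η) (hη.const_smul _) (by simp [η, defectVariation_zero])
    (by simp [η, defectVariation_one hΛ hu]) fun t ht ↦
      (norm_fst_le _).trans ((hnorm t ht).trans hκρ)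
  rw [hfirst] at hvar
  have hκs : κ = √κ * √κ := (Real.mul_self_sqrt hκ.le).symm
  refine le_of_mul_le_mul_left ?_ hs
  nlinarith

end Variation

section Compactness

theorem tendsto_of_tendsto_comp_of_injOn {ι X Y : Type*} [TopologicalSpace X] [TopologicalSpace Y]
    [T2Space Y] {K : Set X} (hK : IsCompact K) {f : X → Y} (hf : ContinuousOn f K)
    (hinj : InjOn f K) {l : Filter ι} {g : ι → X} (hg : ∀ᶠ i in l, g i ∈ K) {x : X} (hx : x ∈ K)
    (hfg : Tendsto (f ∘ g) l (𝓝 (f x))) : Tendsto g l (𝓝 x) := by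
  refine hK.tendsto_nhds_of_unique_mapClusterPt hg fun y hy hcluster ↦ hinj hy hx ?_
  have hfy : MapClusterPt (f y) l (f ∘ g) :=
    hcluster.tendsto_comp' ((hf y hy).mono_left (inf_le_inf_left _ (le_principal_iff.2 hg)))
  have : (𝓝 (f y) ⊓ 𝓝 (f x)).NeBot := hfy.clusterPt.mono hfg
  exact eq_of_nhds_neBot this

theorem exists_subseq_tendsto_of_lipschitzWith {α β : Type*} [PseudoMetricSpace α] [CompactSpace α]
    [MetricSpace β] {C : NNReal} {S : Set β} (hS : IsCompact S)
    {f : ℕ → α → β} (hf : ∀ n, LipschitzWith C (f n)) (hfS : ∀ n t, f n t ∈ S) :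
    ∃ (θ : ℕ → ℕ) (g : α → β), StrictMono θ ∧ Continuous g ∧
      ∀ t, Tendsto (fun n ↦ f (θ n) t) atTop (𝓝 (g t)) := by
  let A : Set (BoundedContinuousFunction α β) := {f | LipschitzWith C f} ∩ ⋂ t, {f | f t ∈ S}
  have heval : ∀ t, Continuous fun f : BoundedContinuousFunction α β ↦ f t :=
    fun t ↦ continuous_eval_const t
  have hclosed : IsClosed A :=
    ((isClosed_setOfPred_lipschitzWith C).preimage (continuous_pi heval)).inter
      (isClosed_iInter fun t ↦ hS.isClosed.preimage (heval t))
  have hA : IsCompact A := BoundedContinuousFunction.arzela_ascoli₂ S hS A hclosed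
    (fun f t hf ↦ mem_iInter.1 hf.2 t)
    (LipschitzWith.uniformEquicontinuous _ C fun f ↦ f.2.1).equicontinuous
  obtain ⟨g, -, θ, hθ, hg⟩ := hA.tendsto_subseq
    (x := fun n ↦ BoundedContinuousFunction.mkOfCompact ⟨f n, (hf n).continuous⟩)
    fun n ↦ ⟨hf n, mem_iInter.2 (hfS n)⟩
  exact ⟨θ, g, hθ, g.continuous, fun t ↦ ((heval t).tendsto g).comp hg⟩

theorem exists_subseq_ae_tendsto_zero {α : Type*} [MeasurableSpace α] {μ : Measure α}
    {h : ℕ → α → ℝ} (hi : ∀ n, Integrable (h n) μ) (h0 : ∀ n t, 0 ≤ h n t)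
    (hlim : Tendsto (fun n ↦ ∫ t, h n t ∂μ) atTop (𝓝 0)) :
    ∃ θ : ℕ → ℕ, StrictMono θ ∧ ∀ᵐ t ∂μ, Tendsto (fun n ↦ h (θ n) t) atTop (𝓝 0) := by
  have hnorm : ∀ n, eLpNorm (h n - fun _ ↦ 0) 1 μ = ENNReal.ofReal (∫ t, h n t ∂μ) := fun n ↦ by
    rw [eLpNorm_one_eq_lintegral_enorm,
      ofReal_integral_eq_lintegral_ofReal (hi n) (ae_of_all _ (h0 n))]
    refine lintegral_congr fun t ↦ ?_
    simp [Real.enorm_of_nonneg (h0 n t)]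
  refine (tendstoInMeasure_of_tendsto_eLpNorm one_ne_zero
    (fun n ↦ (hi n).aestronglyMeasurable) aestronglyMeasurable_const ?_).exists_seq_tendsto_ae
  simp only [hnorm]
  simpa using ENNReal.tendsto_ofReal hlim

theorem mem_of_ae_mem_of_continuousOn {X : Type*} [PseudoMetricSpace X] {S : Set X}
    (hS : IsClosed S) {f : ℝ → X} (hf : ContinuousOn f (Icc 0 1))
    (hfS : ∀ᵐ t ∂volume.restrict (Icc (0 : ℝ) 1), f t ∈ S) : ∀ t ∈ Icc (0 : ℝ) 1, f t ∈ S := by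
  have : (ae (volume.restrict (Icc (0 : ℝ) 1))).NeBot := ae_restrict_neBot.2 (by simp)
  obtain ⟨t₀, ht₀⟩ := hfS.exists
  have hzero : (fun t ↦ Metric.infDist (f t) S) =ᵐ[volume.restrict (Icc (0 : ℝ) 1)] 0 :=
    hfS.mono fun t ht ↦ Metric.infDist_zero_of_mem ht
  exact fun t ht ↦ (hS.mem_iff_infDist_zero ⟨_, ht₀⟩).2
    (Measure.eqOn_Icc_of_ae_eq volume zero_ne_one hzero
      ((Metric.continuous_infDist_pt S).comp_continuousOn hf) continuousOn_const ht)

theorem exists_continuous_lift_of_ae_tendsto {X Y : Type*} [TopologicalSpace X]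
    [PseudoMetricSpace Y] [T2Space Y] {K : Set X} (hK : IsCompact K) {f : X → Y}
    (hf : ContinuousOn f K) (hinj : InjOn f K) {z : ℕ → ℝ → X}
    (hz : ∀ n, ∀ t ∈ Icc (0 : ℝ) 1, z n t ∈ K) {g : ℝ → Y} (hg : ContinuousOn g (Icc 0 1))
    (hlim : ∀ᵐ t ∂volume.restrict (Icc (0 : ℝ) 1),
      Tendsto (fun n ↦ f (z n t)) atTop (𝓝 (g t))) :
    ∃ Z : ℝ → X, Continuous Z ∧ (∀ t ∈ Icc (0 : ℝ) 1, f (Z t) = g t) ∧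
      ∀ᵐ t ∂volume.restrict (Icc (0 : ℝ) 1), Tendsto (fun n ↦ z n t) atTop (𝓝 (Z t)) := by
  have hclosed : IsClosed (f '' K) := (hK.image_of_continuousOn hf).isClosed
  have hgK : ∀ t ∈ Icc (0 : ℝ) 1, g t ∈ f '' K := by
    refine mem_of_ae_mem_of_continuousOn hclosed hg ?_
    filter_upwards [hlim, self_mem_ae_restrict measurableSet_Icc] with t ht htI
    exact hclosed.mem_of_tendsto ht (Eventually.of_forall fun n ↦ mem_image_of_mem f (hz n t htI))
  have : Nonempty X := ⟨z 0 0⟩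
  choose! Z hZK hZ using hgK
  have hZc : ContinuousOn Z (Icc 0 1) := fun t ht ↦ by
    refine tendsto_of_tendsto_comp_of_injOn hK hf hinj
      (eventually_mem_nhdsWithin.mono hZK) (hZK t ht) ?_
    rw [hZ t ht]
    exact (hg t ht).congr' (eventually_mem_nhdsWithin.mono fun s hs ↦ (hZ s hs).symm)
  have hext : ∀ t ∈ Icc (0 : ℝ) 1, IccExtend zero_le_one ((Icc 0 1).domRestrict Z) t = Z t :=
    fun t ht ↦ IccExtend_of_mem _ _ ht
  refine ⟨_, hZc.domRestrict.Icc_extend', fun t ht ↦ by rw [hext t ht, hZ t ht], ?_⟩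
  filter_upwards [hlim, self_mem_ae_restrict measurableSet_Icc] with t ht htI
  rw [hext t htI]
  refine tendsto_of_tendsto_comp_of_injOn hK hf hinj
    (Eventually.of_forall fun n ↦ hz n t htI) (hZK t htI) ?_
  rwa [hZ t htI]

theorem eq_integral_of_tendsto {E : Type*} [NormedAddCommGroup E] [NormedSpace ℝ E]
    [CompleteSpace E] {u : ℕ → ℝ → E} {U V : ℝ → E} {C : ℝ} (hu : ∀ n, ContDiff ℝ 1 (u n))
    (hu' : ∀ n, ∀ t ∈ Icc (0 : ℝ) 1, ‖deriv (u n) t‖ ≤ C)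
    (hU : ∀ t ∈ Icc (0 : ℝ) 1, Tendsto (fun n ↦ u n t) atTop (𝓝 (U t)))
    (hV : ∀ᵐ t ∂volume.restrict (Icc (0 : ℝ) 1),
      Tendsto (fun n ↦ deriv (u n) t) atTop (𝓝 (V t))) :
    ∀ t ∈ Icc (0 : ℝ) 1, U t = U 0 + ∫ s in (0 : ℝ)..t, V s := by
  intro t ht
  have hsub : uIoc 0 t ⊆ Icc 0 1 := by
    rw [uIoc_of_le ht.1]
    exact fun s hs ↦ ⟨hs.1.le, hs.2.trans ht.2⟩
  have hint : Tendsto (fun n ↦ ∫ s in (0 : ℝ)..t, deriv (u n) s) atTop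
      (𝓝 (∫ s in (0 : ℝ)..t, V s)) := by
    refine intervalIntegral.tendsto_integral_filter_of_dominated_convergence (fun _ ↦ C)
      (Eventually.of_forall fun n ↦ ((hu n).continuous_deriv le_rfl).aestronglyMeasurable)
      (Eventually.of_forall fun n ↦ ae_of_all _ fun s hs ↦ hu' n s (hsub hs)) (by simp) ?_
    rw [ae_restrict_iff' measurableSet_Icc] at hV
    filter_upwards [hV] with s hs hs' using hs (hsub hs')
  have hFTC : ∀ n, u n 0 + ∫ s in (0 : ℝ)..t, deriv (u n) s = u n t := fun n ↦ by
    rw [intervalIntegral.integral_deriv_eq_sub (fun s _ ↦ (hu n).differentiable one_ne_zero s)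
      (((hu n).continuous_deriv le_rfl).intervalIntegrable _ _), add_sub_cancel]
  refine tendsto_nhds_unique (hU t ht) ?_
  simpa only [hFTC] using (hU 0 (left_mem_Icc.2 zero_le_one)).add hint

variable {E : Type*} [NormedAddCommGroup E] [NormedSpace ℝ E]

theorem exists_subseq_ae_tendsto_zero_of_integral_sq_apply [FiniteDimensional ℝ E]
    {D : ℕ → ℝ → E →L[ℝ] ℝ} (hD : ∀ n, Continuous (D n))
    (hlim : ∀ e, Tendsto (fun n ↦ ∫ t in (0 : ℝ)..1, (D n t e) ^ 2) atTop (𝓝 0)) :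
    ∃ θ : ℕ → ℕ, StrictMono θ ∧
      ∀ᵐ t ∂volume.restrict (Icc (0 : ℝ) 1), Tendsto (fun n ↦ D (θ n) t) atTop (𝓝 0) := by
  let b := Module.finBasis ℝ E
  obtain ⟨C, -, hC⟩ := b.exists_opNorm_le (F := ℝ)
  let h : ℕ → ℝ → ℝ := fun n t ↦ ∑ i, (D n t (b i)) ^ 2
  have hsq : ∀ n e, Continuous fun t ↦ (D n t e) ^ 2 := fun n e ↦
    ((hD n).clm_apply continuous_const).pow 2
  have hnorm : ∀ n t, ‖D n t‖ ≤ C * √(h n t) := fun n t ↦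
    hC (Real.sqrt_nonneg _) fun i ↦ Real.abs_le_sqrt
      (Finset.single_le_sum (fun j _ ↦ sq_nonneg (D n t (b j))) (Finset.mem_univ i))
  have hh : Tendsto (fun n ↦ ∫ t in Icc (0 : ℝ) 1, h n t) atTop (𝓝 0) := by
    have hsum := tendsto_finsetSum Finset.univ fun i _ ↦ hlim (b i)
    simp only [Finset.sum_const_zero] at hsum
    refine hsum.congr fun n ↦ ?_
    rw [integral_Icc_eq_integral_Ioc, ← intervalIntegral.integral_of_le zero_le_one,
      intervalIntegral.integral_finsetSum fun i _ ↦ (hsq n (b i)).intervalIntegrable _ _]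
  obtain ⟨θ, hθ, hae⟩ := exists_subseq_ae_tendsto_zero
    (fun n ↦ (continuous_finsetSum _ fun i _ ↦ hsq n (b i)).continuousOn.integrableOn_Icc)
    (fun n t ↦ Finset.sum_nonneg fun i _ ↦ sq_nonneg (D n t (b i))) hh
  refine ⟨θ, hθ, hae.mono fun t ht ↦ squeeze_zero_norm (fun n ↦ hnorm (θ n) t) ?_⟩
  simpa using ht.sqrt.const_mul C

/-- A sequence of curves of class `C¹` whose phases `(u, u')` stay in `K` and whose actions are,
in the limit, minimal among the curves at distance at most `ρ`. -/
structure IsMinimizingSequence (Λ : E × E → ℝ) (K : Set (E × E)) (ρ : ℝ) (u : ℕ → ℝ → E) :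
    Prop where
  contDiff n : ContDiff ℝ 1 (u n)
  phase_mem n : ∀ t ∈ Icc (0 : ℝ) 1, (u n t, deriv (u n) t) ∈ K
  isAlmostMinimizing : ∃ κ : ℕ → ℝ, (∀ n, 0 < κ n) ∧ Tendsto κ atTop (𝓝 0) ∧
    ∀ n, IsAlmostMinimizing Λ ρ (κ n) (u n)

namespace IsMinimizingSequence

variable {Λ : E × E → ℝ} {K : Set (E × E)} {ρ : ℝ} {u : ℕ → ℝ → E}

theorem comp (hu : IsMinimizingSequence Λ K ρ u) {θ : ℕ → ℕ} (hθ : StrictMono θ) :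
    IsMinimizingSequence Λ K ρ fun n ↦ u (θ n) where
  contDiff n := hu.contDiff (θ n)
  phase_mem n := hu.phase_mem (θ n)
  isAlmostMinimizing :=
    let ⟨κ, hκ, hκ0, hmin⟩ := hu.isAlmostMinimizing
    ⟨κ ∘ θ, fun n ↦ hκ (θ n), hκ0.comp hθ.tendsto_atTop, fun n ↦ hmin (θ n)⟩

theorem exists_norm_fderiv_le (hu : IsMinimizingSequence Λ K ρ u) (hΛ : ContDiff ℝ 1 Λ)
    (hK : IsCompact K) :
    ∃ B, ∀ n, ∀ t ∈ Icc (0 : ℝ) 1, ‖fderiv ℝ Λ (u n t, deriv (u n) t)‖ ≤ B :=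
  let ⟨B, hB⟩ := hK.exists_bound_of_continuousOn (hΛ.continuous_fderiv one_ne_zero).continuousOn
  ⟨B, fun n t ht ↦ hB _ (hu.phase_mem n t ht)⟩

theorem tendsto_integral_sq_eulerLagrangeDefect [FiniteDimensional ℝ E]
    (hu : IsMinimizingSequence Λ K ρ u) (hΛ : ContDiff ℝ 2 Λ) (hK : IsCompact K) (hρ : 0 < ρ)
    (e : E) :
    Tendsto (fun n ↦ ∫ t in (0 : ℝ)..1, (eulerLagrangeDefect Λ (u n) t e) ^ 2) atTop (𝓝 0) := by
  have hΛ1 : ContDiff ℝ 1 Λ := hΛ.of_le one_le_two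
  obtain ⟨M, hM0, hM⟩ := exists_taylor_bound hΛ hK
  obtain ⟨B, hB⟩ := hu.exists_norm_fderiv_le hΛ1 hK
  obtain ⟨κ, hκ, hκ0, hmin⟩ := hu.isAlmostMinimizing
  have hsqrt : Tendsto (fun n ↦ √(κ n)) atTop (𝓝 0) := by simpa using hκ0.sqrt
  have hsmall : Tendsto (fun n ↦ √(κ n) * (4 * B * ‖e‖ ^ 2)) atTop (𝓝 0) := by
    simpa using hsqrt.mul_const _
  have hbound : Tendsto (fun n ↦ √(κ n) * (1 + M * (4 * B * ‖e‖ ^ 2) ^ 2)) atTop (𝓝 0) := by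
    simpa using hsqrt.mul_const _
  refine squeeze_zero' (Eventually.of_forall fun n ↦
    intervalIntegral.integral_nonneg zero_le_one fun _ _ ↦ sq_nonneg _) ?_ hbound
  filter_upwards [hsmall.eventually_le_const one_pos, hsmall.eventually_le_const hρ] with n h1 h2
  exact integral_sq_eulerLagrangeDefect_le hΛ1 (hu.contDiff n) hM0
    (fun t ht ↦ hM _ (hu.phase_mem n t ht)) (fun t ht ↦ norm_eulerLagrangeDefect_le (hB n) ht)
    (hκ n) h1 h2 (hmin n)

theorem exists_subseq_tendsto_momentum_sub_defect [FiniteDimensional ℝ E]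
    (hu : IsMinimizingSequence Λ K ρ u) (hΛ : ContDiff ℝ 1 Λ) (hK : IsCompact K) :
    ∃ (θ : ℕ → ℕ) (g : Icc (0 : ℝ) 1 → E × (E →L[ℝ] ℝ)), StrictMono θ ∧ Continuous g ∧
      ∀ t : Icc (0 : ℝ) 1, Tendsto (fun n ↦ (u (θ n) t,
        momentum Λ (u (θ n)) t - eulerLagrangeDefect Λ (u (θ n)) t)) atTop (𝓝 (g t)) := by
  obtain ⟨B, hB⟩ := hu.exists_norm_fderiv_le hΛ hK
  obtain ⟨R, hR⟩ := hK.isBounded.exists_norm_le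
  have hphase : ∀ n, ∀ t ∈ Icc (0 : ℝ) 1, ‖(u n t, deriv (u n) t)‖ ≤ R := fun n t ht ↦
    hR _ (hu.phase_mem n t ht)
  let f : ℕ → ℝ → E × (E →L[ℝ] ℝ) := fun n t ↦
    (u n t, momentum Λ (u n) t - eulerLagrangeDefect Λ (u n) t)
  have hderiv : ∀ n t, HasDerivAt (f n) (deriv (u n) t, force Λ (u n) t) t := fun n t ↦
    (((hu.contDiff n).differentiable one_ne_zero t).hasDerivAt).prodMk
      (hasDerivAt_momentum_sub_defect hΛ (hu.contDiff n) t)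
  have hlip : ∀ n, LipschitzOnWith (max R B).toNNReal (f n) (Icc 0 1) := fun n ↦
    (convex_Icc (0 : ℝ) 1).lipschitzOnWith_of_nnnorm_hasDerivWithin_le
      (fun t _ ↦ (hderiv n t).hasDerivWithinAt) fun t ht ↦
        (max_le_max ((norm_snd_le _).trans (hphase n t ht)) (norm_force_le (hB n) ht)).trans
          (Real.le_coe_toNNReal _)
  have hmem : ∀ n (t : Icc (0 : ℝ) 1),
      f n t ∈ Metric.closedBall 0 R ×ˢ Metric.closedBall 0 (B + 4 * B) := fun n t ↦
    ⟨mem_closedBall_zero_iff.2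
        ((norm_fst_le (u n t, deriv (u n) t)).trans (hphase n t t.2)),
      mem_closedBall_zero_iff.2 ((norm_sub_le _ _).trans
        (add_le_add (norm_momentum_le (hB n) t.2) (norm_eulerLagrangeDefect_le (hB n) t.2)))⟩
  exact exists_subseq_tendsto_of_lipschitzWith
    ((isCompact_closedBall _ _).prod (isCompact_closedBall _ _)) (fun n ↦ (hlip n).to_restrict) hmem

theorem exists_subseq_ae_tendsto_legendreMap [FiniteDimensional ℝ E]
    (hu : IsMinimizingSequence Λ K ρ u) (hΛ : ContDiff ℝ 2 Λ) (hK : IsCompact K) (hρ : 0 < ρ) :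
    ∃ (θ : ℕ → ℕ) (g : ℝ → E × (E →L[ℝ] ℝ)), StrictMono θ ∧ Continuous g ∧
      (∀ t ∈ Icc (0 : ℝ) 1, Tendsto (fun n ↦ u (θ n) t) atTop (𝓝 (g t).1)) ∧
      ∀ᵐ t ∂volume.restrict (Icc (0 : ℝ) 1),
        Tendsto (fun n ↦ legendreMap Λ (u (θ n) t, deriv (u (θ n)) t)) atTop (𝓝 (g t)) := by
  have hΛ1 : ContDiff ℝ 1 Λ := hΛ.of_le one_le_two
  obtain ⟨θ₁, hθ₁, hdefect⟩ := exists_subseq_ae_tendsto_zero_of_integral_sq_apply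
    (fun n ↦ continuous_eulerLagrangeDefect hΛ1 (hu.contDiff n))
    (hu.tendsto_integral_sq_eulerLagrangeDefect hΛ hK hρ)
  obtain ⟨θ₂, g, hθ₂, hg, hlim⟩ := (hu.comp hθ₁).exists_subseq_tendsto_momentum_sub_defect hΛ1 hK
  have hgt : ∀ t (ht : t ∈ Icc (0 : ℝ) 1), IccExtend zero_le_one g t = g ⟨t, ht⟩ := fun t ht ↦
    IccExtend_of_mem _ _ ht
  refine ⟨θ₁ ∘ θ₂, IccExtend zero_le_one g, hθ₁.comp hθ₂, hg.Icc_extend', fun t ht ↦ ?_, ?_⟩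
  · rw [hgt t ht]
    exact (hlim ⟨t, ht⟩).fst_nhds
  · filter_upwards [hdefect, self_mem_ae_restrict measurableSet_Icc] with t hzero ht
    rw [hgt t ht]
    have hmom := (hlim ⟨t, ht⟩).snd_nhds.add (hzero.comp hθ₂.tendsto_atTop)
    simp only [Function.comp_apply, sub_add_cancel, add_zero] at hmom
    exact (hlim ⟨t, ht⟩).fst_nhds.prodMk_nhds hmom

theorem exists_subseq_tendsto [FiniteDimensional ℝ E]
    (hu : IsMinimizingSequence Λ K ρ u) (hΛ : ContDiff ℝ 2 Λ) (hK : IsCompact K) (hρ : 0 < ρ)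
    (hinj : InjOn (legendreMap Λ) K) :
    ∃ (θ : ℕ → ℕ) (U : ℝ → E), StrictMono θ ∧ ContDiff ℝ 1 U ∧
      (∀ t ∈ Icc (0 : ℝ) 1, Tendsto (fun n ↦ u (θ n) t) atTop (𝓝 (U t))) ∧
      ∀ᵐ t ∂volume.restrict (Icc (0 : ℝ) 1),
        Tendsto (fun n ↦ (u (θ n) t, deriv (u (θ n)) t)) atTop (𝓝 (U t, deriv U t)) := by
  obtain ⟨θ, g, hθ, hg, hlim, hae⟩ := hu.exists_subseq_ae_tendsto_legendreMap hΛ hK hρ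
  obtain ⟨Z, hZ, hZg, hZlim⟩ := exists_continuous_lift_of_ae_tendsto hK
    (continuous_legendreMap (hΛ.of_le one_le_two)).continuousOn hinj
    (fun n ↦ hu.phase_mem (θ n)) hg.continuousOn hae
  obtain ⟨R, hR⟩ := hK.isBounded.exists_norm_le
  have hint := eq_integral_of_tendsto (fun n ↦ hu.contDiff (θ n))
    (fun n t ht ↦ (norm_snd_le _).trans (hR _ (hu.phase_mem (θ n) t ht))) hlim
    (hZlim.mono fun t ht ↦ ht.snd_nhds)
  have hV : Continuous fun t ↦ (Z t).2 := continuous_snd.comp hZ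
  refine ⟨θ, fun t ↦ (g 0).1 + ∫ s in (0 : ℝ)..t, (Z s).2, hθ, contDiff_add_integral hV _,
    fun t ht ↦ by simpa only [← hint t ht] using hlim t ht, ?_⟩
  filter_upwards [hZlim, self_mem_ae_restrict measurableSet_Icc] with t ht htI
  have hfst : (g 0).1 + ∫ s in (0 : ℝ)..t, (Z s).2 = (Z t).1 :=
    (hint t htI).symm.trans (congrArg Prod.fst (hZg t htI)).symm
  rwa [(hasDerivAt_add_integral hV (g 0).1 t).deriv, hfst]

end IsMinimizingSequence

end Compactness

section Coordinates

/-- A real number in `(0, 1)` as a point of the manifold `(0, 1)`, with a junk value elsewhere. -/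
def toUnitIoo (y : ℝ) : UnitIoo :=
  if h : y ∈ Ioo (0 : ℝ) 1 then ⟨y, h⟩ else ⟨1 / 2, by norm_num, by norm_num⟩

theorem coe_toUnitIoo {y : ℝ} (h : y ∈ Ioo (0 : ℝ) 1) : (toUnitIoo y : ℝ) = y := by
  simp only [toUnitIoo, dif_pos h]

theorem toUnitIoo_coe (y : UnitIoo) : toUnitIoo y = y := Subtype.ext (coe_toUnitIoo y.2)

theorem contMDiffAt_toUnitIoo {y : ℝ} (h : y ∈ Ioo (0 : ℝ) 1) :
    ContMDiffAt 𝓘(ℝ, ℝ) 𝓘(ℝ, ℝ) ∞ toUnitIoo y := by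
  rw [← ContMDiffAt.subtypeVal_comp_iff]
  refine contMDiffAt_id.congr_of_eventuallyEq ?_
  filter_upwards [isOpen_Ioo.mem_nhds h] with z hz using coe_toUnitIoo hz

/-- The curve on the surface of revolution whose coordinates `(x, φ)` at time `t` are `u t`. -/
def revCurve (u : ℝ → ℝ × ℝ) (t : ℝ) : RevSurface := (toUnitIoo (u t).1, Circle.exp (u t).2)

theorem revCurve_eq {u : ℝ → ℝ × ℝ} {p : RevSurface} {φ t : ℝ} (hu : u t = ((p.1 : ℝ), φ))
    (hφ : Circle.exp φ = p.2) : revCurve u t = p := by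
  simp only [revCurve, hu, toUnitIoo_coe, hφ]

theorem contMDiffOn_revCurve {u : ℝ → ℝ × ℝ} {s : Set ℝ} (hu : ContDiffOn ℝ 1 u s)
    (hs : ∀ t ∈ s, (u t).1 ∈ Ioo (0 : ℝ) 1) :
    ContMDiffOn 𝓘(ℝ, ℝ) revModel 1 (revCurve u) s := by
  have hfst : ContMDiffOn 𝓘(ℝ, ℝ) 𝓘(ℝ, ℝ) 1 (fun t ↦ toUnitIoo (u t).1) s := fun t ht ↦
    ((contMDiffAt_toUnitIoo (hs t ht)).of_le (by simp)).comp_contMDiffWithinAt t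
      (hu.fst.contMDiffOn t ht)
  exact hfst.prodMk (contMDiff_circleExp.comp_contMDiffOn hu.snd.contMDiffOn)

theorem exists_eq_revCurve {γ : ℝ → RevSurface} (hγ : ContMDiff 𝓘(ℝ, ℝ) revModel 1 γ) {φ₀ : ℝ}
    (h₀ : Circle.exp φ₀ = (γ 0).2) :
    ∃ u : ℝ → ℝ × ℝ, ContDiff ℝ 1 u ∧ (∀ t, (u t).1 ∈ Ioo (0 : ℝ) 1) ∧ (u 0).2 = φ₀ ∧
      γ = revCurve u := by
  have hfst : ContDiff ℝ 1 (fun t ↦ ((γ t).1 : ℝ)) :=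
    (contMDiff_subtype_val.comp (contMDiff_fst.comp hγ)).contDiff
  have hsnd : ContDiff ℝ 1 (fun t ↦ ((γ t).2 : ℂ)) :=
    ((contMDiff_circle_coe.of_le (by simp)).comp (contMDiff_snd.comp hγ)).contDiff
  obtain ⟨φ, hφ, hφ0, hlift⟩ := exists_lift_circle hsnd h₀
  exact ⟨fun t ↦ ((γ t).1, φ t), hfst.prodMk hφ, fun t ↦ (γ t).1.2, hφ0,
    funext fun t ↦ Prod.ext (toUnitIoo_coe _).symm (hlift t).symm⟩

/-- The squared `k`-length `(1 + r'(x)²) v² + r(x)² w²` of the tangent vector `v ∂_x + w ∂_φ` at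
the point with coordinates `(x, φ)`, as a function of the phase `((x, φ), (v, w))`. -/
def revSpeedSq (r : ℝ → ℝ) (z : (ℝ × ℝ) × ℝ × ℝ) : ℝ :=
  (1 + deriv r z.1.1 ^ 2) * z.2.1 ^ 2 + r z.1.1 ^ 2 * z.2.2 ^ 2

variable {r : ℝ → ℝ}

theorem revSpeedSq_nonneg (z : (ℝ × ℝ) × ℝ × ℝ) : 0 ≤ revSpeedSq r z := by
  unfold revSpeedSq; positivity

theorem sq_le_revSpeedSq (z : (ℝ × ℝ) × ℝ × ℝ) : z.2.1 ^ 2 ≤ revSpeedSq r z := by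
  unfold revSpeedSq
  nlinarith [mul_nonneg (sq_nonneg (deriv r z.1.1)) (sq_nonneg z.2.1),
    mul_nonneg (sq_nonneg (r z.1.1)) (sq_nonneg z.2.2)]

theorem revSpeedSq_smul (y v : ℝ × ℝ) (c : ℝ) :
    revSpeedSq r (y, c • v) = c ^ 2 * revSpeedSq r (y, v) := by
  simp only [revSpeedSq, Prod.smul_fst, Prod.smul_snd, smul_eq_mul]; ring

theorem contDiff_revSpeedSq (hr : ContDiff ℝ ∞ r) : ContDiff ℝ ∞ (revSpeedSq r) := by
  have hr' : ContDiff ℝ ∞ (deriv r) := (contDiff_infty_iff_deriv.1 hr).2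
  exact ((contDiff_const.add ((hr'.comp contDiff_fst.fst).pow 2)).mul (contDiff_snd.fst.pow 2)).add
    (((hr.comp contDiff_fst.fst).pow 2).mul (contDiff_snd.snd.pow 2))

theorem continuous_revSpeedSq_curve (hr : ContDiff ℝ ∞ r) {u : ℝ → ℝ × ℝ} (hu : ContDiff ℝ 1 u) :
    Continuous fun t ↦ revSpeedSq r (u t, deriv u t) :=
  continuous_lagrangian (contDiff_revSpeedSq hr).continuous hu

/-- The velocity in `ℝ³` of a curve on the surface of revolution with coordinates `y` and coordinate
velocity `v`. -/
def embeddedVelocity (r : ℝ → ℝ) (y v : ℝ × ℝ) : EuclideanSpace ℝ (Fin 3) :=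
  !₂[v.1, deriv r y.1 * v.1 * Real.cos y.2 + r y.1 * (-Real.sin y.2 * v.2),
    deriv r y.1 * v.1 * Real.sin y.2 + r y.1 * (Real.cos y.2 * v.2)]

theorem norm_sq_embeddedVelocity (y v : ℝ × ℝ) :
    ‖embeddedVelocity r y v‖ ^ 2 = revSpeedSq r (y, v) := by
  rw [EuclideanSpace.norm_sq_eq, Fin.sum_univ_three]
  simp only [embeddedVelocity, revSpeedSq, PiLp.toLp_apply, Real.norm_eq_abs, sq_abs,
    Matrix.cons_val]
  linear_combination
    (deriv r y.1 ^ 2 * v.1 ^ 2 + r y.1 ^ 2 * v.2 ^ 2) * Real.sin_sq_add_cos_sq y.2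

theorem hasDerivWithinAt_revEmbedding_revCurve (hr : Differentiable ℝ r) {u : ℝ → ℝ × ℝ}
    {v : ℝ × ℝ} {s : Set ℝ} {t : ℝ} (hu : HasDerivWithinAt u v s t) (ht : t ∈ s)
    (hs : ∀ t ∈ s, (u t).1 ∈ Ioo (0 : ℝ) 1) :
    HasDerivWithinAt (revEmbedding r ∘ revCurve u) (embeddedVelocity r (u t) v) s t := by
  have hx : HasDerivWithinAt (fun t ↦ (u t).1) v.1 s t := hu.fst
  have hφ : HasDerivWithinAt (fun t ↦ (u t).2) v.2 s t := hu.snd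
  have hrx := (hr (u t).1).hasDerivAt.comp_hasDerivWithinAt t hx
  have hpolar : ∀ t ∈ s, (revEmbedding r ∘ revCurve u) t =
      !₂[(u t).1, r (u t).1 * Real.cos (u t).2, r (u t).1 * Real.sin (u t).2] := fun t ht ↦ by
    simp only [Function.comp_apply, revCurve, revEmbedding_exp, coe_toUnitIoo (hs t ht)]
  refine HasDerivWithinAt.congr ?_ hpolar (hpolar t ht)
  rw [hasDerivWithinAt_iff_hasFDerivWithinAt, hasFDerivWithinAt_euclidean]
  intro i
  fin_cases i
  · exact hx.hasFDerivWithinAt.congr_fderiv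
      (ContinuousLinearMap.ext_ring (by simp [embeddedVelocity]))
  · exact (hrx.mul hφ.cos).hasFDerivWithinAt.congr_fderiv
      (ContinuousLinearMap.ext_ring (by simp [embeddedVelocity]))
  · exact (hrx.mul hφ.sin).hasFDerivWithinAt.congr_fderiv
      (ContinuousLinearMap.ext_ring (by simp [embeddedVelocity]))

theorem revMetric_inner_revCurve (hr : ContDiff ℝ ∞ r) (hpos : ∀ x ∈ Ioo (0 : ℝ) 1, 0 < r x)
    {u : ℝ → ℝ × ℝ} {s : Set ℝ} {t : ℝ} (hu : ContDiff ℝ 1 u)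
    (hs : ∀ t ∈ s, (u t).1 ∈ Ioo (0 : ℝ) 1) (ht : t ∈ s) (hst : UniqueDiffWithinAt ℝ s t) :
    (revMetric r hr hpos).inner (revCurve u t)
      (mfderivWithin 𝓘(ℝ, ℝ) revModel (revCurve u) s t (1 : ℝ))
      (mfderivWithin 𝓘(ℝ, ℝ) revModel (revCurve u) s t (1 : ℝ)) =
      revSpeedSq r (u t, deriv u t) := by
  have hchain := mfderiv_comp_mfderivWithin t
    ((contMDiff_revEmbedding r hr).mdifferentiableAt (x := revCurve u t) (by simp))
    ((contMDiffOn_revCurve hu.contDiffOn hs).mdifferentiableOn one_ne_zero t ht)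
    hst.uniqueMDiffWithinAt
  have hderiv := hasDerivWithinAt_revEmbedding_revCurve (hr.differentiable (by simp))
    (hu.differentiable one_ne_zero t).hasDerivAt.hasDerivWithinAt ht hs
  have hvel : mfderiv revModel 𝓘(ℝ, EuclideanSpace ℝ (Fin 3)) (revEmbedding r) (revCurve u t)
      (mfderivWithin 𝓘(ℝ, ℝ) revModel (revCurve u) s t (1 : ℝ)) =
      embeddedVelocity r (u t) (deriv u t) := by
    refine (congrArg (fun L ↦ L (1 : ℝ)) hchain).symm.trans ?_
    rw [mfderivWithin_eq_fderivWithin, hderiv.hasFDerivWithinAt.fderivWithin hst]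
    exact one_smul ℝ _
  rw [← norm_sq_embeddedVelocity, ← real_inner_self_eq_norm_sq, ← hvel]
  rfl

end Coordinates

section Distance

variable {r : ℝ → ℝ} (hr : ContDiff ℝ ∞ r) (hpos : ∀ x ∈ Ioo (0 : ℝ) 1, 0 < r x)

theorem revEDist_self (p : RevSurface) : revEDist r hr hpos p p = 0 := by
  let _ : RiemannianBundle (fun p : RevSurface ↦ TangentSpace revModel p) :=
    ⟨(revMetric r hr hpos).toRiemannianMetric⟩
  exact riemannianEDist_self

theorem revEDist_comm (p q : RevSurface) : revEDist r hr hpos p q = revEDist r hr hpos q p := by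
  let _ : RiemannianBundle (fun p : RevSurface ↦ TangentSpace revModel p) :=
    ⟨(revMetric r hr hpos).toRiemannianMetric⟩
  exact riemannianEDist_comm

theorem revEDist_triangle (p q s : RevSurface) :
    revEDist r hr hpos p s ≤ revEDist r hr hpos p q + revEDist r hr hpos q s := by
  let _ : RiemannianBundle (fun p : RevSurface ↦ TangentSpace revModel p) :=
    ⟨(revMetric r hr hpos).toRiemannianMetric⟩
  exact riemannianEDist_triangle

theorem eventually_revEDist_lt (p : RevSurface) {c : ENNReal} (hc : 0 < c) :
    ∀ᶠ q in 𝓝 p, revEDist r hr hpos p q < c := by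
  let _ : RiemannianBundle (fun p : RevSurface ↦ TangentSpace revModel p) :=
    ⟨(revMetric r hr hpos).toRiemannianMetric⟩
  have : IsContMDiffRiemannianBundle revModel ∞ (ℝ × EuclideanSpace ℝ (Fin 1))
      (fun p : RevSurface ↦ TangentSpace revModel p) :=
    ⟨(revMetric r hr hpos).inner, (revMetric r hr hpos).contMDiff, fun _ _ _ ↦ rfl⟩
  have : IsContinuousRiemannianBundle (ℝ × EuclideanSpace ℝ (Fin 1))
      (fun p : RevSurface ↦ TangentSpace revModel p) :=
    ⟨(revMetric r hr hpos).inner, (revMetric r hr hpos).contMDiff.continuous, fun _ _ _ ↦ rfl⟩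
  exact eventually_riemannianEDist_lt revModel p hc

theorem revEDist_le_ofReal_integral {γ : ℝ → RevSurface} {a b : ℝ} (hab : a ≤ b)
    (hγ : ContMDiffOn 𝓘(ℝ, ℝ) revModel 1 γ (Icc a b)) {v : ℝ → ℝ} (hv : ContinuousOn v (Icc a b))
    (hv0 : ∀ t ∈ Icc a b, 0 ≤ v t)
    (h : ∀ t ∈ Icc a b, (revMetric r hr hpos).inner (γ t)
      (mfderivWithin 𝓘(ℝ, ℝ) revModel γ (Icc a b) t (1 : ℝ))
      (mfderivWithin 𝓘(ℝ, ℝ) revModel γ (Icc a b) t (1 : ℝ)) ≤ v t ^ 2) :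
    revEDist r hr hpos (γ a) (γ b) ≤ ENNReal.ofReal (∫ t in a..b, v t) := by
  let _ : RiemannianBundle (fun p : RevSurface ↦ TangentSpace revModel p) :=
    ⟨(revMetric r hr hpos).toRiemannianMetric⟩
  refine (riemannianEDist_le_pathELength hγ rfl rfl hab).trans ?_
  rw [pathELength_eq_lintegral_mfderivWithin_Icc, intervalIntegral.integral_of_le hab,
    ← integral_Icc_eq_integral_Ioc, ofReal_integral_eq_lintegral_ofReal]
  · refine setLIntegral_mono' measurableSet_Icc fun t ht ↦ ?_
    rw [← ofReal_norm, norm_eq_sqrt_real_inner]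
    exact ENNReal.ofReal_le_ofReal (Real.sqrt_le_iff.2 ⟨hv0 t ht, h t ht⟩)
  · exact hv.integrableOn_Icc
  · filter_upwards [self_mem_ae_restrict measurableSet_Icc] with t ht using hv0 t ht

theorem exists_curve_of_revEDist_lt {p q : RevSurface} {c : ENNReal}
    (h : revEDist r hr hpos p q < c) :
    ∃ γ : ℝ → RevSurface, γ 0 = p ∧ γ 1 = q ∧ ContMDiff 𝓘(ℝ, ℝ) revModel 1 γ ∧
      ∫⁻ t in Icc (0 : ℝ) 1, ENNReal.ofReal (√((revMetric r hr hpos).inner (γ t)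
        (mfderiv 𝓘(ℝ, ℝ) revModel γ t (1 : ℝ)) (mfderiv 𝓘(ℝ, ℝ) revModel γ t (1 : ℝ)))) < c := by
  let _ : RiemannianBundle (fun p : RevSurface ↦ TangentSpace revModel p) :=
    ⟨(revMetric r hr hpos).toRiemannianMetric⟩
  obtain ⟨γ, h0, h1, hγ, hlength, -⟩ :=
    exists_lt_locally_constant_of_riemannianEDist_lt (I := revModel) h zero_lt_one
  refine ⟨γ, h0, h1, hγ, lt_of_eq_of_lt ?_ hlength⟩
  rw [pathELength_eq_lintegral_mfderiv_Icc]
  refine setLIntegral_congr_fun measurableSet_Icc fun t _ ↦ ?_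
  rw [← ofReal_norm, norm_eq_sqrt_real_inner]
  rfl

/-- The `k`-length over `[a, b]` of the curve with coordinates `u`. -/
def revLength (r : ℝ → ℝ) (u : ℝ → ℝ × ℝ) (a b : ℝ) : ℝ :=
  ∫ t in a..b, √(revSpeedSq r (u t, deriv u t))

theorem revLength_nonneg (u : ℝ → ℝ × ℝ) {a b : ℝ} (hab : a ≤ b) : 0 ≤ revLength r u a b :=
  intervalIntegral.integral_nonneg hab fun _ _ ↦ Real.sqrt_nonneg _

include hr in
theorem revLength_add {u : ℝ → ℝ × ℝ} (hu : ContDiff ℝ 1 u) (a b c : ℝ) :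
    revLength r u a b + revLength r u b c = revLength r u a c :=
  intervalIntegral.integral_add_adjacent_intervals
    ((continuous_revSpeedSq_curve hr hu).sqrt.intervalIntegrable _ _)
    ((continuous_revSpeedSq_curve hr hu).sqrt.intervalIntegrable _ _)

include hr in
theorem abs_fst_sub_le_revLength {u : ℝ → ℝ × ℝ} (hu : ContDiff ℝ 1 u) {a b : ℝ} (hab : a ≤ b) :
    |(u b).1 - (u a).1| ≤ revLength r u a b := by
  have hderiv : ∀ t, HasDerivAt (fun t ↦ (u t).1) (deriv u t).1 t := fun t ↦
    (hu.differentiable one_ne_zero t).hasDerivAt.fst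
  have hcont : Continuous fun t ↦ (deriv u t).1 := (hu.continuous_deriv le_rfl).fst
  rw [← intervalIntegral.integral_eq_sub_of_hasDerivAt (fun t _ ↦ hderiv t)
    (hcont.intervalIntegrable _ _)]
  refine (intervalIntegral.abs_integral_le_integral_abs hab).trans ?_
  exact intervalIntegral.integral_mono_on hab (hcont.abs.intervalIntegrable _ _)
    ((continuous_revSpeedSq_curve hr hu).sqrt.intervalIntegrable _ _)
    fun t _ ↦ Real.abs_le_sqrt (sq_le_revSpeedSq (u t, deriv u t))

theorem revEDist_revCurve_le {u : ℝ → ℝ × ℝ} {a b : ℝ} (hu : ContDiff ℝ 1 u) (hab : a ≤ b)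
    (h : ∀ t ∈ Icc a b, (u t).1 ∈ Ioo (0 : ℝ) 1) :
    revEDist r hr hpos (revCurve u a) (revCurve u b) ≤ ENNReal.ofReal (revLength r u a b) := by
  rcases hab.eq_or_lt with rfl | hab'
  · simp [revEDist_self]
  refine revEDist_le_ofReal_integral hr hpos hab (contMDiffOn_revCurve hu.contDiffOn h)
    (continuous_revSpeedSq_curve hr hu).sqrt.continuousOn (fun _ _ ↦ Real.sqrt_nonneg _)
    fun t ht ↦ ?_
  rw [Real.sq_sqrt (revSpeedSq_nonneg _)]
  exact (revMetric_inner_revCurve hr hpos hu h ht (uniqueDiffOn_Icc hab' t ht)).le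

theorem revEDist_ne_top (p q : RevSurface) : revEDist r hr hpos p q ≠ ⊤ := by
  let x : ℝ → ℝ := fun t ↦ (p.1 : ℝ) + t * ((q.1 : ℝ) - p.1)
  let φ : ℝ → ℝ := fun t ↦ Complex.arg p.2 + t * (Complex.arg q.2 - Complex.arg p.2)
  let u : ℝ → ℝ × ℝ := fun t ↦ (x t, φ t)
  have hu : ContDiff ℝ 1 u := by fun_prop
  have hmem : ∀ t ∈ Icc (0 : ℝ) 1, (u t).1 ∈ Ioo (0 : ℝ) 1 := fun t ht ↦
    (convex_Ioo (0 : ℝ) 1).add_smul_sub_mem p.1.2 q.1.2 ht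
  have hle := revEDist_revCurve_le hr hpos hu zero_le_one hmem
  rw [revCurve_eq (p := p) (φ := Complex.arg p.2) (by simp [u, x, φ]) (Circle.exp_arg _),
    revCurve_eq (p := q) (φ := Complex.arg q.2) (by simp [u, x, φ]) (Circle.exp_arg _)] at hle
  exact ne_top_of_le_ne_top ENNReal.ofReal_ne_top hle

/-- The distance `dist_k` on the surface of revolution, as a real number. -/
def revDist (p q : RevSurface) : ℝ := (revEDist r hr hpos p q).toReal

theorem ofReal_revDist (p q : RevSurface) :
    ENNReal.ofReal (revDist hr hpos p q) = revEDist r hr hpos p q :=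
  ENNReal.ofReal_toReal (revEDist_ne_top hr hpos p q)

theorem revDist_nonneg (p q : RevSurface) : 0 ≤ revDist hr hpos p q := ENNReal.toReal_nonneg

theorem revDist_self (p : RevSurface) : revDist hr hpos p p = 0 := by
  simp [revDist, revEDist_self]

theorem revDist_comm (p q : RevSurface) : revDist hr hpos p q = revDist hr hpos q p := by
  simp only [revDist, revEDist_comm hr hpos p q]

theorem revDist_triangle (p q s : RevSurface) :
    revDist hr hpos p s ≤ revDist hr hpos p q + revDist hr hpos q s := by
  have hpq := revEDist_ne_top hr hpos p q
  have hqs := revEDist_ne_top hr hpos q s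
  unfold revDist
  rw [← ENNReal.toReal_add hpq hqs]
  exact ENNReal.toReal_mono (ENNReal.add_ne_top.2 ⟨hpq, hqs⟩) (revEDist_triangle hr hpos p q s)

theorem eventually_revDist_lt (p : RevSurface) {ε : ℝ} (hε : 0 < ε) :
    ∀ᶠ q in 𝓝 p, revDist hr hpos p q < ε := by
  filter_upwards [eventually_revEDist_lt hr hpos p (ENNReal.ofReal_pos.2 hε)] with q hq
  rwa [← ofReal_revDist, ENNReal.ofReal_lt_ofReal_iff hε] at hq

theorem continuous_revDist :
    Continuous fun x : RevSurface × RevSurface ↦ revDist hr hpos x.1 x.2 := by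
  rw [continuous_iff_continuousAt]
  rintro ⟨p, q⟩
  rw [Metric.continuousAt_iff']
  intro ε hε
  filter_upwards [(eventually_revDist_lt hr hpos p (half_pos hε)).prod_nhds
    (eventually_revDist_lt hr hpos q (half_pos hε))] with y hy
  rw [Real.dist_eq, abs_sub_lt_iff]
  have := revDist_triangle hr hpos y.1 p y.2
  have := revDist_triangle hr hpos p q y.2
  have := revDist_triangle hr hpos p y.1 q
  have := revDist_triangle hr hpos y.1 y.2 q
  have := revDist_comm hr hpos y.1 p
  have := revDist_comm hr hpos y.2 q
  constructor <;> linarith [hy.1, hy.2]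

theorem revDist_revCurve_le {u : ℝ → ℝ × ℝ} {a b : ℝ} (hu : ContDiff ℝ 1 u) (hab : a ≤ b)
    (h : ∀ t ∈ Icc a b, (u t).1 ∈ Ioo (0 : ℝ) 1) :
    revDist hr hpos (revCurve u a) (revCurve u b) ≤ revLength r u a b :=
  ENNReal.toReal_le_of_le_ofReal (revLength_nonneg u hab)
    (revEDist_revCurve_le hr hpos hu hab h)

/-- The `C¹` curve with coordinates `u` runs on the surface of revolution from `p` to `q` as the
parameter runs through `[0, 1]`. -/
structure IsRevPath (p q : RevSurface) (u : ℝ → ℝ × ℝ) : Prop where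
  contDiff : ContDiff ℝ 1 u
  mem_Ioo : ∀ t ∈ Icc (0 : ℝ) 1, (u t).1 ∈ Ioo (0 : ℝ) 1
  source : revCurve u 0 = p
  target : revCurve u 1 = q

namespace IsRevPath

variable {hr hpos} {p q : RevSurface} {u : ℝ → ℝ × ℝ}

theorem fst_zero (hu : IsRevPath p q u) : (u 0).1 = p.1 := by
  rw [← hu.source]
  exact (coe_toUnitIoo (hu.mem_Ioo 0 unitInterval.zero_mem)).symm

theorem fst_one (hu : IsRevPath p q u) : (u 1).1 = q.1 := by
  rw [← hu.target]
  exact (coe_toUnitIoo (hu.mem_Ioo 1 unitInterval.one_mem)).symm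

theorem revDist_le_revLength (hu : IsRevPath p q u) : revDist hr hpos p q ≤ revLength r u 0 1 := by
  simpa only [hu.source, hu.target] using
    revDist_revCurve_le hr hpos hu.contDiff zero_le_one hu.mem_Ioo

theorem sq_revDist_le_action (hu : IsRevPath p q u) :
    revDist hr hpos p q ^ 2 ≤ action (revSpeedSq r) u := by
  calc revDist hr hpos p q ^ 2 ≤ revLength r u 0 1 ^ 2 :=
        pow_le_pow_left₀ (revDist_nonneg hr hpos p q) hu.revDist_le_revLength 2
    _ ≤ ∫ t in (0 : ℝ)..1, √(revSpeedSq r (u t, deriv u t)) ^ 2 :=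
        sq_integral_le_integral_sq (continuous_revSpeedSq_curve hr hu.contDiff).sqrt
    _ = action (revSpeedSq r) u := by
        simp only [Real.sq_sqrt (revSpeedSq_nonneg _), action]

theorem exists_speed_le (hr : ContDiff ℝ ∞ r) (hu : IsRevPath p q u) {c : ℝ}
    (hc : revLength r u 0 1 < c) :
    ∃ w, IsRevPath p q w ∧ w 0 = u 0 ∧ ∀ t, revSpeedSq r (w t, deriv w t) ≤ c ^ 2 := by
  obtain ⟨τ, hτ, hτ0, hτ1, hspeed⟩ := exists_reparametrization
    (continuous_revSpeedSq_curve hr hu.contDiff).sqrt (fun _ ↦ Real.sqrt_nonneg _) hc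
  have hmono : Monotone τ := monotone_of_deriv_nonneg (hτ.differentiable one_ne_zero)
    fun t ↦ (hspeed t).1
  have hderiv : ∀ t, deriv (u ∘ τ) t = deriv τ t • deriv u (τ t) := fun t ↦
    deriv.scomp t (hu.contDiff.differentiable one_ne_zero _) (hτ.differentiable one_ne_zero t)
  refine ⟨u ∘ τ, ⟨hu.contDiff.comp hτ, fun t ht ↦ hu.mem_Ioo _ ?_, ?_, ?_⟩, ?_, fun t ↦ ?_⟩
  · exact ⟨hτ0 ▸ hmono ht.1, hτ1 ▸ hmono ht.2⟩
  · simpa only [revCurve, Function.comp_apply, hτ0] using hu.source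
  · simpa only [revCurve, Function.comp_apply, hτ1] using hu.target
  · rw [Function.comp_apply, hτ0]
  · obtain ⟨hτ', hle⟩ := hspeed t
    rw [Function.comp_apply, hderiv, revSpeedSq_smul,
      ← Real.sq_sqrt (revSpeedSq_nonneg (r := r) (u (τ t), _)), ← mul_pow]
    exact pow_le_pow_left₀ (mul_nonneg hτ' (Real.sqrt_nonneg _)) hle 2

end IsRevPath

theorem exists_isRevPath_revLength_lt {p q : RevSurface} {φ₀ c : ℝ} (hφ₀ : Circle.exp φ₀ = p.2)
    (hc : revDist hr hpos p q < c) :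
    ∃ u, IsRevPath p q u ∧ (u 0).2 = φ₀ ∧ revLength r u 0 1 < c := by
  have hc0 : 0 < c := (revDist_nonneg hr hpos p q).trans_lt hc
  rw [← ENNReal.ofReal_lt_ofReal_iff hc0, ofReal_revDist] at hc
  obtain ⟨γ, rfl, rfl, hγ, hlength⟩ := exists_curve_of_revEDist_lt hr hpos hc
  obtain ⟨u, hu, hmem, hu0, rfl⟩ := exists_eq_revCurve hγ hφ₀
  refine ⟨u, ⟨hu, fun t _ ↦ hmem t, rfl, rfl⟩, hu0, ?_⟩
  have hinner := fun t ↦ revMetric_inner_revCurve hr hpos hu (s := univ) (fun t _ ↦ hmem t)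
    (mem_univ t) uniqueDiffWithinAt_univ
  simp only [mfderivWithin_univ] at hinner
  simp only [hinner] at hlength
  have hcont := (continuous_revSpeedSq_curve hr hu).sqrt
  rw [← ofReal_integral_eq_lintegral_ofReal hcont.continuousOn.integrableOn_Icc
    (ae_of_all _ fun _ ↦ Real.sqrt_nonneg _), ENNReal.ofReal_lt_ofReal_iff hc0,
    integral_Icc_eq_integral_Ioc, ← intervalIntegral.integral_of_le zero_le_one] at hlength
  exact hlength

end Distance

section Confinement

variable {r : ℝ → ℝ} {hr : ContDiff ℝ ∞ r} {hpos : ∀ x ∈ Ioo (0 : ℝ) 1, 0 < r x}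

theorem revDist_latitude_le (hr : ContDiff ℝ ∞ r) (hpos : ∀ x ∈ Ioo (0 : ℝ) 1, 0 < r x)
    (l : UnitIoo) (z w : Circle) : revDist hr hpos (l, z) (l, w) ≤ 2 * Real.pi * r l := by
  obtain ⟨β, hβ, hexp⟩ :=
    Circle.periodic_exp.exists_mem_Ico Real.two_pi_pos (Complex.arg w) (Complex.arg z)
  set α := Complex.arg z
  let u : ℝ → ℝ × ℝ := fun t ↦ (l, α + t * (β - α))
  have hderiv : ∀ t, deriv u t = (0, β - α) := fun t ↦ by
    have hφ : HasDerivAt (fun t ↦ α + t * (β - α)) (β - α) t := by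
      simpa using ((hasDerivAt_id t).mul_const (β - α)).const_add α
    exact ((hasDerivAt_const t (l : ℝ)).prodMk hφ).deriv
  have hspeed : ∀ t, √(revSpeedSq r (u t, deriv u t)) = r l * (β - α) := fun t ↦ by
    rw [hderiv, ← Real.sqrt_sq (mul_nonneg (hpos l l.2).le (sub_nonneg.2 hβ.1))]
    simp [revSpeedSq, u, mul_pow]
  have hpath : IsRevPath (l, z) (l, w) u := by
    refine ⟨by fun_prop, fun _ _ ↦ l.2, revCurve_eq (φ := α) (by simp [u]) (Circle.exp_arg z),
      revCurve_eq (φ := β) (by simp [u]) ?_⟩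
    rw [← hexp, Circle.exp_arg]
  have hle := hpath.revDist_le_revLength (hr := hr) (hpos := hpos)
  simp only [revLength, hspeed, intervalIntegral.integral_const, sub_zero, one_smul] at hle
  nlinarith [hβ.2, hpos l l.2]

namespace IsRevPath

variable {p q : RevSurface} {u : ℝ → ℝ × ℝ}

theorem revDist_add_le_of_excursion (hu : IsRevPath p q u) {t₁ s t₂ : ℝ} (h₁ : t₁ ∈ Icc 0 s)
    (h₂ : t₂ ∈ Icc s 1) (heq : (u t₁).1 = (u t₂).1) :
    revDist hr hpos p q + 2 * |(u s).1 - (u t₁).1| ≤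
      revLength r u 0 1 + 2 * Real.pi * r (u t₁).1 := by
  have hmem : (u t₁).1 ∈ Ioo (0 : ℝ) 1 := hu.mem_Ioo _ ⟨h₁.1, by linarith [h₁.2, h₂.1, h₂.2]⟩
  have hstart : revDist hr hpos p (revCurve u t₁) ≤ revLength r u 0 t₁ := by
    rw [← hu.source]
    exact revDist_revCurve_le hr hpos hu.contDiff h₁.1
      fun t ht ↦ hu.mem_Ioo t ⟨ht.1, by linarith [ht.2, h₁.2, h₂.1, h₂.2]⟩
  have hend : revDist hr hpos (revCurve u t₂) q ≤ revLength r u t₂ 1 := by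
    rw [← hu.target]
    exact revDist_revCurve_le hr hpos hu.contDiff h₂.2
      fun t ht ↦ hu.mem_Ioo t ⟨by linarith [ht.1, h₁.1, h₁.2, h₂.1], ht.2⟩
  have hcircle : revDist hr hpos (revCurve u t₁) (revCurve u t₂) ≤ 2 * Real.pi * r (u t₁).1 := by
    simpa only [revCurve, heq, coe_toUnitIoo (heq ▸ hmem)] using
      revDist_latitude_le hr hpos (toUnitIoo (u t₁).1) (Circle.exp (u t₁).2) (Circle.exp (u t₂).2)
  have hleave := abs_fst_sub_le_revLength hr hu.contDiff h₁.2
  have hreturn := abs_fst_sub_le_revLength hr hu.contDiff h₂.1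
  rw [← heq, abs_sub_comm] at hreturn
  have hsplit₁ := revLength_add hr hu.contDiff 0 t₁ s
  have hsplit₂ := revLength_add hr hu.contDiff s t₂ 1
  have hsplit := revLength_add hr hu.contDiff 0 s 1
  have htri₁ := revDist_triangle hr hpos p (revCurve u t₁) q
  have htri₂ := revDist_triangle hr hpos (revCurve u t₁) (revCurve u t₂) q
  linarith

theorem revDist_add_le (hu : IsRevPath p q u) {s l : ℝ} (hs : s ∈ Icc (0 : ℝ) 1)
    (hp : l ∈ uIcc (p.1 : ℝ) (u s).1) (hq : l ∈ uIcc (u s).1 (q.1 : ℝ)) :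
    revDist hr hpos p q + 2 * |(u s).1 - l| ≤ revLength r u 0 1 + 2 * Real.pi * r l := by
  have hcont : Continuous fun t ↦ (u t).1 := hu.contDiff.continuous.fst
  rw [← hu.fst_zero] at hp
  rw [← hu.fst_one] at hq
  obtain ⟨t₁, h₁, rfl⟩ := intermediate_value_uIcc hcont.continuousOn hp
  obtain ⟨t₂, h₂, heq⟩ := intermediate_value_uIcc hcont.continuousOn hq
  rw [uIcc_of_le hs.1] at h₁
  rw [uIcc_of_le hs.2] at h₂
  exact hu.revDist_add_le_of_excursion h₁ h₂ heq.symm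

end IsRevPath

theorem exists_two_pi_mul_lt_near_zero (hr : DifferentiableAt ℝ r 0) (h0 : r 0 = 0)
    (hd0 : |deriv r 0| < 1 / (2 * Real.pi)) {c : ℝ} (hc : 0 < c) :
    ∃ l ∈ Ioc 0 c, 2 * Real.pi * r l < l := by
  have hslope := hr.hasDerivAt.tendsto_slope_zero_right
  simp only [zero_add, h0, sub_zero, smul_eq_mul] at hslope
  obtain ⟨l, hl, hlc⟩ := ((hslope.eventually (eventually_lt_nhds
    ((le_abs_self _).trans_lt hd0))).and (Ioc_mem_nhdsGT hc)).exists
  rw [inv_mul_lt_iff₀ hlc.1, mul_one_div, lt_div_iff₀ Real.two_pi_pos] at hl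
  exact ⟨l, hlc, by linarith⟩

theorem exists_two_pi_mul_lt_near_one (hr : DifferentiableAt ℝ r 1) (h1 : r 1 = 0)
    (hd1 : |deriv r 1| < 1 / (2 * Real.pi)) {c : ℝ} (hc : 0 < c) :
    ∃ l ∈ Ioc 0 c, 2 * Real.pi * r (1 - l) < l := by
  have hreflect : DifferentiableAt ℝ (fun t ↦ r (1 - t)) 0 :=
    differentiableAt_comp_const_sub.2 (by simpa using hr)
  refine exists_two_pi_mul_lt_near_zero hreflect (by simpa using h1) ?_ hc
  rw [deriv_comp_const_sub, abs_neg, sub_zero]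
  exact hd1

theorem exists_forall_isRevPath_mem_Icc (hr : ContDiff ℝ ∞ r)
    (hpos : ∀ x ∈ Ioo (0 : ℝ) 1, 0 < r x) (h0 : r 0 = 0) (h1 : r 1 = 0)
    (hd0 : |deriv r 0| < 1 / (2 * Real.pi)) (hd1 : |deriv r 1| < 1 / (2 * Real.pi))
    (p q : RevSurface) :
    ∃ δ > 0, ∃ ε > 0, ∀ u, IsRevPath p q u → revLength r u 0 1 < revDist hr hpos p q + ε →
      ∀ t ∈ Icc (0 : ℝ) 1, (u t).1 ∈ Icc δ (1 - δ) := by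
  have hdiff : Differentiable ℝ r := hr.differentiable (by simp)
  obtain ⟨l, ⟨hl0, hlc⟩, hl⟩ := exists_two_pi_mul_lt_near_zero (hdiff 0) h0 hd0
    (lt_min p.1.2.1 q.1.2.1)
  obtain ⟨m, ⟨hm0, hmc⟩, hm⟩ := exists_two_pi_mul_lt_near_one (hdiff 1) h1 hd1
    (lt_min (sub_pos.2 p.1.2.2) (sub_pos.2 q.1.2.2))
  rw [le_min_iff] at hlc hmc
  refine ⟨min (l / 2) (m / 2), by positivity, min (l - 2 * Real.pi * r l)
    (m - 2 * Real.pi * r (1 - m)), lt_min (by linarith) (by linarith), fun u hu hlen t ht ↦ ?_⟩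
  rw [← sub_lt_iff_lt_add', lt_min_iff] at hlen
  refine ⟨?_, ?_⟩ <;> by_contra! hlt
  · have hlt' := hlt.trans_le (min_le_left _ _)
    have := hu.revDist_add_le (hr := hr) (hpos := hpos) ht (l := l)
      (mem_uIcc.2 (.inr ⟨by linarith, hlc.1⟩)) (mem_uIcc.2 (.inl ⟨by linarith, hlc.2⟩))
    linarith [neg_abs_le ((u t).1 - l)]
  · have hlt' : 1 - m / 2 < (u t).1 := by linarith [min_le_right (l / 2) (m / 2)]
    have := hu.revDist_add_le (hr := hr) (hpos := hpos) ht (l := 1 - m)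
      (mem_uIcc.2 (.inl ⟨by linarith, by linarith⟩)) (mem_uIcc.2 (.inr ⟨by linarith, by linarith⟩))
    linarith [le_abs_self ((u t).1 - (1 - m))]

end Confinement

section Minimizers

variable {r : ℝ → ℝ} {p q : RevSurface} {u : ℝ → ℝ × ℝ}

theorem tendsto_revCurve {ι : Type*} {l : Filter ι} {u : ι → ℝ → ℝ × ℝ} {U : ℝ → ℝ × ℝ} {t : ℝ}
    (hu : Tendsto (fun n ↦ u n t) l (𝓝 (U t))) (ht : (U t).1 ∈ Ioo (0 : ℝ) 1) :
    Tendsto (fun n ↦ revCurve (u n) t) l (𝓝 (revCurve U t)) :=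
  ((contMDiffAt_toUnitIoo ht).continuousAt.tendsto.comp hu.fst_nhds).prodMk_nhds
    ((Circle.exp.continuous.tendsto _).comp hu.snd_nhds)

theorem fderiv_revSpeedSq_apply_inr (hr : ContDiff ℝ ∞ r) (y v w : ℝ × ℝ) :
    fderiv ℝ (revSpeedSq r) (y, v) (0, w) =
      2 * (1 + deriv r y.1 ^ 2) * v.1 * w.1 + 2 * r y.1 ^ 2 * v.2 * w.2 := by
  have hfderiv := ((contDiff_revSpeedSq hr).differentiable (by simp) (y, v)).hasFDerivAt
  refine (hfderiv.hasLineDerivAt (0, w)).unique ?_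
  have haffine : ∀ a b : ℝ, HasDerivAt (fun s ↦ a + s * b) b 0 := fun a b ↦ by
    simpa using ((hasDerivAt_id (0 : ℝ)).mul_const b).const_add a
  have hquad := (((haffine v.1 w.1).pow 2).const_mul (1 + deriv r y.1 ^ 2)).add
    (((haffine v.2 w.2).pow 2).const_mul (r y.1 ^ 2))
  simp only [HasLineDerivAt, revSpeedSq, Prod.mk_add_mk, Prod.smul_mk, smul_zero, add_zero,
    Prod.fst_add, Prod.snd_add, Prod.smul_fst, Prod.smul_snd, smul_eq_mul]
  refine hquad.congr_deriv ?_
  simp only [zero_mul, add_zero, pow_one, Nat.cast_ofNat, Nat.add_one_sub_one]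
  ring

theorem injOn_legendreMap_revSpeedSq (hr : ContDiff ℝ ∞ r) :
    InjOn (legendreMap (revSpeedSq r)) {z | r z.1.1 ≠ 0} := by
  rintro ⟨y, v⟩ hy ⟨y', v'⟩ - heq
  obtain rfl : y = y' := congrArg Prod.fst heq
  have hmomentum : ∀ w, fderiv ℝ (revSpeedSq r) (y, v) (0, w) =
      fderiv ℝ (revSpeedSq r) (y, v') (0, w) := fun w ↦ congrArg (fun z ↦ z.2 w) heq
  simp only [fderiv_revSpeedSq_apply_inr hr] at hmomentum
  have h₁ : (1 + deriv r y.1 ^ 2) * (v.1 - v'.1) = 0 := by linarith [hmomentum (1, 0)]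
  have h₂ : r y.1 ^ 2 * (v.2 - v'.2) = 0 := by linarith [hmomentum (0, 1)]
  have hfst := (mul_eq_zero.1 h₁).resolve_left (by positivity)
  have hsnd := (mul_eq_zero.1 h₂).resolve_left (pow_ne_zero 2 hy)
  exact Prod.ext rfl (Prod.ext (sub_eq_zero.1 hfst) (sub_eq_zero.1 hsnd))

theorem exists_norm_le_of_revSpeedSq_le (hr : Continuous r) {S : Set ℝ} (hS : IsCompact S)
    (hS0 : ∀ x ∈ S, 0 < r x) (c : ℝ) :
    ∃ R, ∀ y v : ℝ × ℝ, y.1 ∈ S → revSpeedSq r (y, v) ≤ c ^ 2 → ‖v‖ ≤ R := by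
  obtain ⟨m, hm, hmr⟩ := hS.exists_forall_le' hr.continuousOn hS0
  refine ⟨max |c| (|c| / m), fun y v hy hv ↦ max_le_max ?_ ?_⟩
  · exact sq_le_sq.1 ((sq_le_revSpeedSq (y, v)).trans hv)
  · rw [Real.norm_eq_abs, le_div_iff₀ hm, ← abs_of_pos hm, ← abs_mul, ← sq_le_sq]
    have hr2 : m ^ 2 ≤ r y.1 ^ 2 := pow_le_pow_left₀ hm.le (hmr _ hy) 2
    calc (v.2 * m) ^ 2 = m ^ 2 * v.2 ^ 2 := by ring
      _ ≤ r y.1 ^ 2 * v.2 ^ 2 := by gcongr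
      _ ≤ revSpeedSq r (y, v) := le_add_of_nonneg_left (by positivity)
      _ ≤ c ^ 2 := hv

theorem exists_isCompact_forall_phase_mem (hr : Continuous r) {S : Set ℝ} (hS : IsCompact S)
    (hS0 : ∀ x ∈ S, 0 < r x) (c : ℝ) (y₀ : ℝ × ℝ) :
    ∃ K : Set ((ℝ × ℝ) × ℝ × ℝ), IsCompact K ∧ (∀ z ∈ K, z.1.1 ∈ S) ∧
      ∀ u : ℝ → ℝ × ℝ, ContDiff ℝ 1 u → u 0 = y₀ → (∀ t ∈ Icc (0 : ℝ) 1, (u t).1 ∈ S) →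
        (∀ t ∈ Icc (0 : ℝ) 1, revSpeedSq r (u t, deriv u t) ≤ c ^ 2) →
        ∀ t ∈ Icc (0 : ℝ) 1, (u t, deriv u t) ∈ K := by
  obtain ⟨R, hR⟩ := exists_norm_le_of_revSpeedSq_le hr hS hS0 c
  refine ⟨(Prod.fst ⁻¹' S ∩ Metric.closedBall y₀ R) ×ˢ Metric.closedBall 0 R,
    ((isCompact_closedBall y₀ R).inter_left (hS.isClosed.preimage continuous_fst)).prod
      (isCompact_closedBall 0 R), fun z hz ↦ hz.1.1, fun u hu hu0 huS hspeed t ht ↦ ?_⟩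
  have hderiv : ∀ s ∈ Icc (0 : ℝ) 1, ‖deriv u s‖ ≤ R := fun s hs ↦
    hR _ _ (huS s hs) (hspeed s hs)
  have hdisp : ‖u t - u 0‖ ≤ R * ‖t - 0‖ :=
    (convex_Icc (0 : ℝ) 1).norm_image_sub_le_of_norm_deriv_le
      (fun s _ ↦ hu.differentiable one_ne_zero s) hderiv unitInterval.zero_mem ht
  have hR0 : 0 ≤ R := (norm_nonneg _).trans (hderiv t ht)
  refine ⟨⟨huS t ht, ?_⟩, mem_closedBall_zero_iff.2 (hderiv t ht)⟩
  rw [mem_closedBall_iff_norm, ← hu0]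
  refine hdisp.trans (mul_le_of_le_one_right hR0 ?_)
  rw [sub_zero, Real.norm_of_nonneg ht.1]
  exact ht.2

namespace IsRevPath

theorem add (hu : IsRevPath p q u) {δ ρ : ℝ} (hδ : ∀ t ∈ Icc (0 : ℝ) 1, (u t).1 ∈ Icc δ (1 - δ))
    (hρ : ρ < δ) {ξ : ℝ → ℝ × ℝ} (hξ : ContDiff ℝ 1 ξ) (hξ0 : ξ 0 = 0) (hξ1 : ξ 1 = 0)
    (hξρ : ∀ t ∈ Icc (0 : ℝ) 1, ‖ξ t‖ ≤ ρ) : IsRevPath p q (u + ξ) where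
  contDiff := hu.contDiff.add hξ
  mem_Ioo t ht := by
    have hfst := abs_le.1 ((norm_fst_le (ξ t)).trans (hξρ t ht))
    have hut := hδ t ht
    exact ⟨by simp only [Pi.add_apply, Prod.fst_add]; linarith [hut.1, hfst.1],
      by simp only [Pi.add_apply, Prod.fst_add]; linarith [hut.2, hfst.2]⟩
  source := by simpa only [revCurve, Pi.add_apply, hξ0, add_zero] using hu.source
  target := by simpa only [revCurve, Pi.add_apply, hξ1, add_zero] using hu.target

theorem isAlmostMinimizing (hr : ContDiff ℝ ∞ r) (hpos : ∀ x ∈ Ioo (0 : ℝ) 1, 0 < r x)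
    (hu : IsRevPath p q u) {δ ρ c : ℝ} (hδ : ∀ t ∈ Icc (0 : ℝ) 1, (u t).1 ∈ Icc δ (1 - δ))
    (hρ : ρ < δ) (hspeed : ∀ t ∈ Icc (0 : ℝ) 1, revSpeedSq r (u t, deriv u t) ≤ c ^ 2) :
    IsAlmostMinimizing (revSpeedSq r) ρ (c ^ 2 - revDist hr hpos p q ^ 2) u := by
  intro ξ hξ hξ0 hξ1 hξρ
  have haction : action (revSpeedSq r) u ≤ c ^ 2 := by
    have hle := intervalIntegral.integral_mono_on zero_le_one
      ((continuous_revSpeedSq_curve hr hu.contDiff).intervalIntegrable _ _)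
      (intervalIntegrable_const (μ := volume)) hspeed
    simpa only [action, intervalIntegral.integral_const, sub_zero, one_smul] using hle
  have hlower : revDist hr hpos p q ^ 2 ≤ action (revSpeedSq r) (u + ξ) :=
    (hu.add hδ hρ hξ hξ0 hξ1 hξρ).sq_revDist_le_action
  linarith

theorem revLength_le_of_speed_le (hr : ContDiff ℝ ∞ r) (hu : IsRevPath p q u) {c : ℝ} (hc : 0 ≤ c)
    (hspeed : ∀ t, revSpeedSq r (u t, deriv u t) ≤ c ^ 2) : revLength r u 0 1 ≤ c := by
  have hle := intervalIntegral.integral_mono_on zero_le_one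
    ((continuous_revSpeedSq_curve hr hu.contDiff).sqrt.intervalIntegrable _ _)
    (intervalIntegrable_const (μ := volume))
    fun t _ ↦ Real.sqrt_le_iff.2 ⟨hc, hspeed t⟩
  simpa only [revLength, intervalIntegral.integral_const, sub_zero, one_smul] using hle

theorem of_tendsto {u : ℕ → ℝ → ℝ × ℝ} {U : ℝ → ℝ × ℝ} (hu : ∀ n, IsRevPath p q (u n))
    (hU : ContDiff ℝ 1 U) (hU01 : ∀ t ∈ Icc (0 : ℝ) 1, (U t).1 ∈ Ioo (0 : ℝ) 1)
    (hlim : ∀ t ∈ Icc (0 : ℝ) 1, Tendsto (fun n ↦ u n t) atTop (𝓝 (U t))) :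
    IsRevPath p q U where
  contDiff := hU
  mem_Ioo := hU01
  source := tendsto_nhds_unique
    (tendsto_revCurve (hlim 0 unitInterval.zero_mem) (hU01 0 unitInterval.zero_mem))
    (by simp only [(hu _).source, tendsto_const_nhds])
  target := tendsto_nhds_unique
    (tendsto_revCurve (hlim 1 unitInterval.one_mem) (hU01 1 unitInterval.one_mem))
    (by simp only [(hu _).target, tendsto_const_nhds])

end IsRevPath

theorem exists_isRevPath_speed_le (hr : ContDiff ℝ ∞ r)
    (hpos : ∀ x ∈ Ioo (0 : ℝ) 1, 0 < r x) {c : ℝ} (hc : revDist hr hpos p q < c) :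
    ∃ u, IsRevPath p q u ∧ u 0 = (↑p.1, Complex.arg p.2) ∧
      ∀ t, revSpeedSq r (u t, deriv u t) ≤ c ^ 2 := by
  obtain ⟨u, hu, hu0, hlength⟩ := exists_isRevPath_revLength_lt hr hpos (Circle.exp_arg p.2) hc
  obtain ⟨w, hw, hw0, hspeed⟩ := hu.exists_speed_le hr hlength
  exact ⟨w, hw, hw0.trans (Prod.ext hu.fst_zero hu0), hspeed⟩

theorem exists_isMinimizingSequence (hr : ContDiff ℝ ∞ r)
    (hpos : ∀ x ∈ Ioo (0 : ℝ) 1, 0 < r x) (h0 : r 0 = 0) (h1 : r 1 = 0)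
    (hd0 : |deriv r 0| < 1 / (2 * Real.pi)) (hd1 : |deriv r 1| < 1 / (2 * Real.pi))
    (p q : RevSurface) :
    ∃ (δ ρ : ℝ) (K : Set ((ℝ × ℝ) × ℝ × ℝ)) (c : ℕ → ℝ) (u : ℕ → ℝ → ℝ × ℝ), 0 < δ ∧ 0 < ρ ∧
      IsCompact K ∧ (∀ z ∈ K, z.1.1 ∈ Icc δ (1 - δ)) ∧
      Tendsto c atTop (𝓝 (revDist hr hpos p q)) ∧ (∀ n, IsRevPath p q (u n)) ∧
      (∀ n t, revSpeedSq r (u n t, deriv (u n) t) ≤ c n ^ 2) ∧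
      IsMinimizingSequence (revSpeedSq r) K ρ u := by
  set D := revDist hr hpos p q
  have hD : 0 ≤ D := revDist_nonneg hr hpos p q
  obtain ⟨δ, hδ, ε, hε, hconf⟩ := exists_forall_isRevPath_mem_Icc hr hpos h0 h1 hd0 hd1 p q
  obtain ⟨c, -, hc, hclim⟩ := exists_seq_strictAnti_tendsto' (lt_add_of_pos_right D hε)
  choose u hu hu0 hspeed using fun n ↦ exists_isRevPath_speed_le hr hpos (hc n).1
  have hmem : ∀ n, ∀ t ∈ Icc (0 : ℝ) 1, (u n t).1 ∈ Icc δ (1 - δ) := fun n ↦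
    hconf (u n) (hu n) (((hu n).revLength_le_of_speed_le hr (hD.trans (hc n).1.le)
      (hspeed n)).trans_lt (hc n).2)
  obtain ⟨K, hK, hKfst, hphase⟩ := exists_isCompact_forall_phase_mem hr.continuous
    (isCompact_Icc (a := δ) (b := 1 - δ))
    (fun x hx ↦ hpos x (Icc_subset_Ioo hδ (sub_lt_self 1 hδ) hx)) (D + ε) (↑p.1, Complex.arg p.2)
  refine ⟨δ, δ / 2, K, c, u, hδ, half_pos hδ, hK, hKfst, hclim, hu, hspeed,
    fun n ↦ (hu n).contDiff, fun n ↦ hphase _ (hu n).contDiff (hu0 n) (hmem n) fun t _ ↦ ?_,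
    fun n ↦ c n ^ 2 - D ^ 2, fun n ↦ sub_pos.2 (pow_lt_pow_left₀ (hc n).1 hD two_ne_zero), ?_,
    fun n ↦ (hu n).isAlmostMinimizing hr hpos (hmem n) (half_lt_self hδ) fun t _ ↦ hspeed n t⟩
  · exact (hspeed n t).trans (pow_le_pow_left₀ (hD.trans (hc n).1.le) (hc n).2.le 2)
  · exact tendsto_sub_nhds_zero_iff.2 (hclim.pow 2)

theorem exists_isRevPath_minimizing (hr : ContDiff ℝ ∞ r)
    (hpos : ∀ x ∈ Ioo (0 : ℝ) 1, 0 < r x) (h0 : r 0 = 0) (h1 : r 1 = 0)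
    (hd0 : |deriv r 0| < 1 / (2 * Real.pi)) (hd1 : |deriv r 1| < 1 / (2 * Real.pi))
    (p q : RevSurface) :
    ∃ u, IsRevPath p q u ∧
      ∀ t ∈ Icc (0 : ℝ) 1, revSpeedSq r (u t, deriv u t) ≤ revDist hr hpos p q ^ 2 := by
  obtain ⟨δ, ρ, K, c, u, hδ, hρ, hK, hKfst, hc, hpath, hspeed, hu⟩ :=
    exists_isMinimizingSequence hr hpos h0 h1 hd0 hd1 p q
  have hsub : Icc δ (1 - δ) ⊆ Ioo (0 : ℝ) 1 := Icc_subset_Ioo hδ (sub_lt_self 1 hδ)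
  have hinj : InjOn (legendreMap (revSpeedSq r)) K :=
    (injOn_legendreMap_revSpeedSq hr).mono fun z hz ↦ (hpos _ (hsub (hKfst z hz))).ne'
  obtain ⟨θ, U, hθ, hU, hlim, hphase⟩ :=
    hu.exists_subseq_tendsto (mod_cast contDiff_infty.1 (contDiff_revSpeedSq hr) 2) hK hρ hinj
  have hUmem : ∀ t ∈ Icc (0 : ℝ) 1, (U t).1 ∈ Ioo (0 : ℝ) 1 := fun t ht ↦
    hsub (isClosed_Icc.mem_of_tendsto (hlim t ht).fst_nhds
      (Eventually.of_forall fun n ↦ hKfst _ (hu.phase_mem (θ n) t ht)))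
  refine ⟨U, .of_tendsto (fun n ↦ hpath (θ n)) hU hUmem hlim,
    mem_of_ae_mem_of_continuousOn isClosed_Iic (continuous_revSpeedSq_curve hr hU).continuousOn ?_⟩
  filter_upwards [hphase] with t ht
  exact le_of_tendsto_of_tendsto'
    (((contDiff_revSpeedSq hr).continuous.tendsto _).comp ht)
    ((hc.comp hθ.tendsto_atTop).pow 2) fun n ↦ hspeed (θ n) t

end Minimizers

section Causality

variable {r : ℝ → ℝ} (hr : ContDiff ℝ ∞ r) (hpos : ∀ x ∈ Ioo (0 : ℝ) 1, 0 < r x)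

theorem staticMetric_timeField (x : ℝ × RevSurface)
    (v : ℝ × (ℝ × EuclideanSpace ℝ (Fin 1))) :
    staticMetric r hr hpos x v ((1 : ℝ), (0 : ℝ × EuclideanSpace ℝ (Fin 1))) = -v.1 := by
  have hzero : (revMetric r hr hpos).inner x.2 v.2 (0 : ℝ × EuclideanSpace ℝ (Fin 1)) = 0 :=
    map_zero _
  calc staticMetric r hr hpos x v ((1 : ℝ), (0 : ℝ × EuclideanSpace ℝ (Fin 1)))
      = -(v.1 * 1) + (revMetric r hr hpos).inner x.2 v.2 (0 : ℝ × EuclideanSpace ℝ (Fin 1)) :=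
        staticMetric_apply r hr hpos x v _
    _ = -v.1 := by rw [hzero, mul_one, add_zero]

theorem isFutureCausal_staticSpacetime_iff (x : ℝ × RevSurface)
    (v : ℝ × (ℝ × EuclideanSpace ℝ (Fin 1))) :
    (staticSpacetime r hr hpos).IsFutureCausal x v ↔
      0 < v.1 ∧ (revMetric r hr hpos).inner x.2 v.2 v.2 ≤ v.1 ^ 2 := by
  have hself := staticMetric_apply r hr hpos x v v
  have htime := staticMetric_timeField hr hpos x v
  change v ≠ 0 ∧ staticMetric r hr hpos x v v ≤ 0 ∧
    staticMetric r hr hpos x v ((1 : ℝ), (0 : ℝ × EuclideanSpace ℝ (Fin 1))) < 0 ↔ _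
  constructor
  · rintro ⟨-, hcausal, hfuture⟩
    exact ⟨neg_lt_zero.1 (htime.symm.trans_lt hfuture),
      by rw [sq]; exact neg_add_nonpos_iff.1 (hself.symm.trans_le hcausal)⟩
  · rintro ⟨htpos, hle⟩
    rw [sq] at hle
    exact ⟨fun h ↦ htpos.ne' (by rw [h]; rfl), hself.trans_le (neg_add_nonpos_iff.2 hle),
      htime.trans_lt (neg_lt_zero.2 htpos)⟩

theorem isFutureCausal_mfderivWithin_iff {γ : ℝ → ℝ × RevSurface} {s : Set ℝ} {t : ℝ}
    (hs : UniqueDiffWithinAt ℝ s t) (hγ : MDifferentiableWithinAt 𝓘(ℝ, ℝ) staticModel γ s t) :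
    (staticSpacetime r hr hpos).IsFutureCausal (γ t)
        (mfderivWithin 𝓘(ℝ, ℝ) staticModel γ s t (1 : ℝ)) ↔
      0 < derivWithin (fun u ↦ (γ u).1) s t ∧
        (revMetric r hr hpos).inner (γ t).2
          (mfderivWithin 𝓘(ℝ, ℝ) revModel (fun u ↦ (γ u).2) s t (1 : ℝ))
          (mfderivWithin 𝓘(ℝ, ℝ) revModel (fun u ↦ (γ u).2) s t (1 : ℝ)) ≤
          derivWithin (fun u ↦ (γ u).1) s t ^ 2 := by
  have hfst := mfderiv_comp_mfderivWithin t
    (mdifferentiableAt_fst (I := 𝓘(ℝ, ℝ)) (I' := revModel) (x := γ t)) hγ hs.uniqueMDiffWithinAt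
  have hsnd := mfderiv_comp_mfderivWithin t
    (mdifferentiableAt_snd (I := 𝓘(ℝ, ℝ)) (I' := revModel) (x := γ t)) hγ hs.uniqueMDiffWithinAt
  rw [mfderiv_fst] at hfst
  rw [mfderiv_snd] at hsnd
  rw [← fderivWithin_derivWithin, ← mfderivWithin_eq_fderivWithin,
    show mfderivWithin 𝓘(ℝ, ℝ) 𝓘(ℝ, ℝ) (fun u ↦ (γ u).1) s t = _ from hfst,
    show mfderivWithin 𝓘(ℝ, ℝ) revModel (fun u ↦ (γ u).2) s t = _ from hsnd]
  exact isFutureCausal_staticSpacetime_iff hr hpos (γ t) _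

theorem lt_and_revDist_le_of_joinedByCausalArc {P Q : ℝ × RevSurface}
    (h : (staticSpacetime r hr hpos).JoinedByCausalArc P Q) :
    P.1 < Q.1 ∧ revDist hr hpos P.2 Q.2 ≤ Q.1 - P.1 := by
  obtain ⟨a, b, γ, hab, rfl, rfl, hγ, hfuture⟩ := h
  have hunique := uniqueDiffOn_Icc hab
  have htime : ContDiffOn ℝ 1 (fun u ↦ (γ u).1) (Icc a b) :=
    contMDiffOn_iff_contDiffOn.1 (contMDiff_fst.comp_contMDiffOn hγ)
  have hspace : ContMDiffOn 𝓘(ℝ, ℝ) revModel 1 (fun u ↦ (γ u).2) (Icc a b) :=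
    contMDiff_snd.comp_contMDiffOn hγ
  have hcausal := fun t ht ↦ (isFutureCausal_mfderivWithin_iff hr hpos (hunique t ht)
    (hγ.mdifferentiableOn one_ne_zero t ht)).1 (hfuture t ht)
  have hcont : ContinuousOn (derivWithin (fun u ↦ (γ u).1) (Icc a b)) (Icc a b) :=
    htime.continuousOn_derivWithin hunique le_rfl
  have helapsed : ∫ t in a..b, derivWithin (fun u ↦ (γ u).1) (Icc a b) t = (γ b).1 - (γ a).1 :=
    intervalIntegral.integral_derivWithin_Icc_of_contDiffOn_Icc htime hab.le
  have hlt : (γ a).1 < (γ b).1 := by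
    rw [← sub_pos, ← helapsed]
    exact intervalIntegral.intervalIntegral_pos_of_pos_on (hcont.intervalIntegrable_of_Icc hab.le)
      (fun t ht ↦ (hcausal t (Ioo_subset_Icc_self ht)).1) hab
  have hdist := revEDist_le_ofReal_integral hr hpos hab.le hspace hcont
    (fun t ht ↦ (hcausal t ht).1.le) fun t ht ↦ (hcausal t ht).2
  rw [helapsed] at hdist
  exact ⟨hlt, ENNReal.toReal_le_of_le_ofReal (sub_nonneg.2 hlt.le) hdist⟩

theorem lt_and_revDist_le_of_joinedByCausalCurve {P Q : ℝ × RevSurface}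
    (h : (staticSpacetime r hr hpos).JoinedByCausalCurve P Q) :
    P.1 < Q.1 ∧ revDist hr hpos P.2 Q.2 ≤ Q.1 - P.1 := by
  induction h with
  | single harc => exact lt_and_revDist_le_of_joinedByCausalArc hr hpos harc
  | tail _ harc ih =>
    obtain ⟨hlt, hdist⟩ := lt_and_revDist_le_of_joinedByCausalArc hr hpos harc
    exact ⟨ih.1.trans hlt, (revDist_triangle hr hpos _ _ _).trans (by linarith [ih.2])⟩

variable {hr hpos} {p q : RevSurface}

theorem IsRevPath.joinedByCausalArc {u : ℝ → ℝ × ℝ} (hu : IsRevPath p q u) {σ τ : ℝ} (hστ : σ < τ)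
    (hspeed : ∀ t ∈ Icc (0 : ℝ) 1, revSpeedSq r (u t, deriv u t) ≤ (τ - σ) ^ 2) :
    (staticSpacetime r hr hpos).JoinedByCausalArc (σ, p) (τ, q) := by
  have hunique := uniqueDiffOn_Icc (zero_lt_one' ℝ)
  have htime : ContDiff ℝ 1 fun t : ℝ ↦ σ + (τ - σ) * t := by fun_prop
  have hγ : ContMDiffOn 𝓘(ℝ, ℝ) staticModel 1
      (fun t ↦ ((σ + (τ - σ) * t, revCurve u t) : ℝ × RevSurface)) (Icc 0 1) :=
    htime.contDiffOn.contMDiffOn.prodMk (contMDiffOn_revCurve hu.contDiff.contDiffOn hu.mem_Ioo)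
  refine ⟨0, 1, _, zero_lt_one, by simp [hu.source], by simp [hu.target], hγ, fun t ht ↦ ?_⟩
  rw [isFutureCausal_mfderivWithin_iff hr hpos (hunique t ht)
    (hγ.mdifferentiableOn one_ne_zero t ht)]
  have hderiv : derivWithin (fun t ↦ σ + (τ - σ) * t) (Icc 0 1) t = τ - σ := by
    have : HasDerivAt (fun t ↦ σ + (τ - σ) * t) (τ - σ) t := by
      simpa using ((hasDerivAt_id t).const_mul (τ - σ)).const_add σ
    exact this.hasDerivWithinAt.derivWithin (hunique t ht)
  simp only [hderiv]
  exact ⟨sub_pos.2 hστ, (revMetric_inner_revCurve hr hpos hu.contDiff hu.mem_Ioo ht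
    (hunique t ht)).trans_le (hspeed t ht)⟩

theorem eq_zero_of_revSpeedSq_eq_zero {y v : ℝ × ℝ} (hy : r y.1 ≠ 0)
    (h : revSpeedSq r (y, v) = 0) : v = 0 := by
  have hfst : v.1 = 0 := pow_eq_zero_iff two_ne_zero |>.1
    (le_antisymm ((sq_le_revSpeedSq (y, v)).trans h.le) (sq_nonneg _))
  rw [revSpeedSq, hfst] at h
  exact Prod.ext hfst (by simpa [hy] using h)

theorem IsRevPath.eq_of_revSpeedSq_eq_zero (hpos : ∀ x ∈ Ioo (0 : ℝ) 1, 0 < r x) {u : ℝ → ℝ × ℝ}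
    (hu : IsRevPath p q u) (h : ∀ t ∈ Icc (0 : ℝ) 1, revSpeedSq r (u t, deriv u t) = 0) :
    p = q := by
  have hderiv : ∀ t ∈ Icc (0 : ℝ) 1, deriv u t = 0 := fun t ht ↦
    eq_zero_of_revSpeedSq_eq_zero (hpos _ (hu.mem_Ioo t ht)).ne' (h t ht)
  have hconst : u 1 = u 0 := constant_of_has_deriv_right_zero hu.contDiff.continuous.continuousOn
    (fun t ht ↦ by
      rw [← hderiv t (Ico_subset_Icc_self ht)]
      exact (hu.contDiff.differentiable one_ne_zero t).hasDerivAt.hasDerivWithinAt)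
    1 unitInterval.one_mem
  rw [← hu.source, ← hu.target, revCurve, revCurve, hconst]

theorem mem_causalRelation_iff (h0 : r 0 = 0) (h1 : r 1 = 0)
    (hd0 : |deriv r 0| < 1 / (2 * Real.pi)) (hd1 : |deriv r 1| < 1 / (2 * Real.pi))
    {P Q : ℝ × RevSurface} :
    (P, Q) ∈ (staticSpacetime r hr hpos).causalRelation ↔
      revDist hr hpos P.2 Q.2 ≤ Q.1 - P.1 := by
  obtain ⟨σ, p⟩ := P
  obtain ⟨τ, q⟩ := Q
  constructor
  · rintro (heq | hjoined)
    · obtain ⟨rfl, rfl⟩ : σ = τ ∧ p = q := Prod.ext_iff.1 heq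
      simp [revDist_self]
    · exact (lt_and_revDist_le_of_joinedByCausalCurve hr hpos hjoined).2
  · intro (hle : revDist hr hpos p q ≤ τ - σ)
    have hdist := revDist_nonneg hr hpos p q
    obtain ⟨u, hu, hspeed⟩ := exists_isRevPath_minimizing hr hpos h0 h1 hd0 hd1 p q
    rcases (hdist.trans hle).eq_or_lt with heq | hlt
    · have hzero : revDist hr hpos p q = 0 := le_antisymm (hle.trans heq.ge) hdist
      simp only [hzero, zero_pow two_ne_zero] at hspeed
      have hpq := hu.eq_of_revSpeedSq_eq_zero hpos
        fun t ht ↦ (hspeed t ht).antisymm (revSpeedSq_nonneg _)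
      exact .inl (Prod.ext (sub_eq_zero.1 heq.symm).symm hpq)
    · exact .inr (.single (hu.joinedByCausalArc (sub_pos.1 hlt)
        fun t ht ↦ (hspeed t ht).trans (pow_le_pow_left₀ hdist hle 2)))

end Causality

end

theorem corollary4p2 (r : ℝ → ℝ) (hr : ContDiff ℝ ∞ r)
    (hpos : ∀ x ∈ Set.Ioo (0 : ℝ) 1, 0 < r x) (h0 : r 0 = 0) (h1 : r 1 = 0)
    (hd0 : |deriv r 0| < 1 / (2 * Real.pi)) (hd1 : |deriv r 1| < 1 / (2 * Real.pi)) :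
    (staticSpacetime r hr hpos).IsCausallySimple ∧
    ∀ (σ τ : ℝ) (p q : RevSurface),
      ((σ, p), (τ, q)) ∈ (staticSpacetime r hr hpos).causalRelation ↔
        ((revEDist r hr hpos p q : ENNReal) : EReal) ≤ ((τ - σ : ℝ) : EReal) := by
  have hJ := @mem_causalRelation_iff r hr hpos h0 h1 hd0 hd1
  refine ⟨⟨fun P hP ↦ ?_, ?_⟩, fun σ τ p q ↦ ?_⟩
  · exact lt_irrefl P.1 (lt_and_revDist_le_of_joinedByCausalCurve hr hpos hP).1
  · have hrel : (staticSpacetime r hr hpos).causalRelation =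
        {x | revDist hr hpos x.1.2 x.2.2 ≤ x.2.1 - x.1.1} := ext fun _ ↦ hJ
    rw [hrel]
    exact isClosed_le ((continuous_revDist hr hpos).comp
      (continuous_fst.snd.prodMk continuous_snd.snd)) (by fun_prop)
  · rw [hJ, ← ofReal_revDist, EReal.coe_ennreal_ofReal,
      max_eq_left (revDist_nonneg hr hpos p q), EReal.coe_le_coe_iff]
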